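/- Let $p$ and $q$ be primes with $p\equiv 1\pmod 8$ and $q\equiv 7\pmod 8$. Suppose $p=c^2+d^2=x^2+2qy^2$ with $c,d,x,y\in\mathbb Z$, where $c\equiv 1\pmod 4$ and $d=2^r d_0$ with $r\ge 0$ and $d_0$ integers and $d_0\equiv 1\pmod 4$. Assume that $\gcd(c,x+d)=1$ or $\gcd(d_0,x+c)=1$. Then for every integer $m$, $$(-q)^{(p-1)/8}\equiv \left(\frac dc\right)^m \pmod p\quad\Longleftrightarrow\quad \left(\frac{c-di}{c+di}\right)^{(q+1)/8}\equiv i^m \pmod q .$$ Here $i=\sqrt{-1}$ and $\frac dc$ denotes the quotient of residue classes modulo $p$. For $z,w\in\mathbb Q(i)$, $z\equiv w\pmod q$ means that $z-w=q\,\frac st$ for some $s,t\in\mathbb Z[i]$ with $t$ relatively prime to $q$ in $\mathbb Z[i]$. -/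

import Mathlib

/-- Congruence modulo `n` between Gaussian fractions (elements of `ℚ(i) ⊆ ℂ`):
`z ≡ w (mod n)` means that `z - w = n * (s / t)` for Gaussian integers `s` and `t`
with `t` relatively prime to `n`. -/
def GaussModEq (n : ℕ) (z w : ℂ) : Prop :=
  ∃ s t : GaussianInt, IsCoprime t (n : GaussianInt) ∧
    z - w = (n : ℂ) * (GaussianInt.toComplex s / GaussianInt.toComplex t)

/-! Put N = (q+1)/8, let z be a primitive eighth root of unity in an algebraic closure K of 𝔽_q, i =
z², π = c + di, π' = c - di. As q is inert in ℤ[i], the right-hand congruence says π'^N = i^m π^N in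
K. Choose a generator g of (ℤ/p)ˣ with g^((p-1)/4) = d/c and the octic character χ with χ(g) = z.
Both -2q and 2 are squares mod p, so -q = g^(2t); the left side says (d/c)^t = (d/c)^m, while χ(-q)
= i^t. Everything reduces to χ(-q) π^N = π'^N (`octic_apply_neg_mul_pow`).

This comes from computing G^(q+1) twice for the Gauss sum G of χ in K. Frobenius gives χ(-q) p
(`gaussSum_pow_succ`). Jacobi sums give G⁸ = p ρ⁴ π², where ρ = J(χ, χ⁴) = A + B√-2 has norm p and
J(χ², χ⁴) = ±π (`gaussSum_pow_eight`, `exists_jacobiSum_octic_eq`). Since p = ππ', what remains is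
(ρπ)^(4N) = p (`mul_pow_half_eq_card`).

In K one has p = x². After making x and A congruent to 1 mod 4 by sign changes, ρ^(4N) and π^(4N)
both equal xε, where ε = ±1 is the common value of the nonzero Legendre symbols of x ± A and x ± d
modulo q (`exists_common_legendreSym`). That coincidence is quadratic reciprocity applied to
differences of the three representations of p. -/

open scoped NumberTheorySymbols

/-! ### Jacobi symbols read off from factored quadratic forms. -/

/-- If `n * k = u² - D w²` for an odd `n` prime to `D`, and no prime divides all of `n, k, u, w`,
then the Jacobi symbol `(D / n)` is `1`. -/
theorem jacobiSym_eq_one_of_mul_eq_sq_sub (D : ℤ) (n : ℕ) (hn : Odd n) (k u w : ℤ)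
    (h : (n : ℤ) * k = u ^ 2 - D * w ^ 2)
    (hprim : ∀ l : ℕ, l.Prime → l ∣ n → (l : ℤ) ∣ k → (l : ℤ) ∣ u → (l : ℤ) ∣ w → False)
    (hD : D.gcd n = 1) : J(D | n) = 1 := by
  induction n using Nat.strong_induction_on generalizing u w with
  | _ n ih =>
  rcases jacobiSym.eq_one_or_neg_one hD with h1 | h1
  · exact h1
  exfalso
  -- A prime l with (D/l) = -1 divides both u and w. Primitivity then keeps l away from k, so l²
  -- divides n; removing l² leaves the symbol unchanged and the induction applies.
  obtain ⟨l, hl, hln, hJ⟩ := jacobiSym.eq_neg_one_at_prime_divisor_of_eq_neg_one h1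
  have : Fact l.Prime := ⟨hl⟩
  have hl0 : (l : ℤ) ≠ 0 := by exact_mod_cast hl.ne_zero
  have hlp : Prime (l : ℤ) := Nat.prime_iff_prime_int.mp hl
  have hdvd : (l : ℤ) ∣ u ^ 2 - D * w ^ 2 :=
    h ▸ Dvd.dvd.mul_right (by exact_mod_cast hln) k
  obtain ⟨hu, hw⟩ := jacobiSym.prime_dvd_of_eq_neg_one hJ hdvd
  have hk : ¬ (l : ℤ) ∣ k := fun hk => hprim l hl hln hk hu hw
  obtain ⟨u', rfl⟩ := hu
  obtain ⟨w', rfl⟩ := hw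
  obtain ⟨n1, rfl⟩ := hln
  have h2 : (n1 : ℤ) * k = l * (u' ^ 2 - D * w' ^ 2) := by
    apply mul_left_cancel₀ hl0
    push_cast at h
    linear_combination h
  have hln1 : (l : ℤ) ∣ n1 := by
    have : (l : ℤ) ∣ (n1 : ℤ) * k := h2 ▸ Dvd.intro _ rfl
    exact (hlp.dvd_or_dvd this).resolve_right hk
  obtain ⟨n2, rfl⟩ : l ∣ n1 := by exact_mod_cast hln1
  have h3 : (n2 : ℤ) * k = u' ^ 2 - D * w' ^ 2 := by
    apply mul_left_cancel₀ hl0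
    push_cast at h2
    linear_combination h2
  have hn2 : Odd n2 := (Nat.odd_mul.mp (Nat.odd_mul.mp hn).2).2
  have hn20 : 0 < n2 := hn2.pos
  have hlt : n2 < l * (l * n2) := by
    have h2 := hl.two_le
    calc n2 < 2 * (2 * n2) := by omega
      _ ≤ l * (l * n2) := by gcongr
  have hDl : IsCoprime D ((l : ℤ) * (l * n2)) := by
    rw [Int.isCoprime_iff_gcd_eq_one]; exact_mod_cast hD
  have hJ2 := ih n2 hlt hn2 u' w' h3
    (fun l' hl' hd hk' hu' hw' => hprim l' hl' ((hd.mul_left l).mul_left l) hk'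
      (hu'.mul_left _) (hw'.mul_left _))
    (Int.isCoprime_iff_gcd_eq_one.mp hDl.of_mul_right_right.of_mul_right_right)
  have : NeZero l := ⟨hl.ne_zero⟩
  have : NeZero n2 := ⟨hn20.ne'⟩
  have hDl' : D.gcd l = 1 := Int.isCoprime_iff_gcd_eq_one.mp hDl.of_mul_right_left
  rw [jacobiSym.mul_right, jacobiSym.mul_right, hJ2, mul_one, ← sq, jacobiSym.sq_one hDl'] at h1
  norm_num at h1

theorem Int.natCast_natAbs_eq_or_eq_neg (n : ℤ) : (n.natAbs : ℤ) = n ∨ (n.natAbs : ℤ) = -n := Int.natAbs_eq n |>.elim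
  (fun h => .inl h.symm) (fun h => .inr (by omega))

/-- Quadratic reciprocity for a prime `q ≡ 3 (mod 4)` and a signed odd integer `n`. -/
theorem legendreSym_eq_χ₄_mul_jacobiSym {q : ℕ} [Fact q.Prime] (hq : q % 4 = 3) {n : ℤ}
    (hn : Odd n) : legendreSym q n = ZMod.χ₄ n * J(q | n.natAbs) := by
  have hqodd : Odd q := Nat.odd_iff.mpr (by omega)
  have hodd : Odd n.natAbs := Int.natAbs_odd.mpr hn
  have key : J(n.natAbs | q) = ZMod.χ₄ n.natAbs * J(q | n.natAbs) := by
    rcases Nat.odd_mod_four_iff.mp (Nat.odd_iff.mp hodd) with h | h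
    · rw [ZMod.χ₄_nat_one_mod_four h, one_mul, jacobiSym.quadratic_reciprocity_one_mod_four h hqodd]
    · rw [ZMod.χ₄_nat_three_mod_four h, jacobiSym.quadratic_reciprocity_three_mod_four h hq]
      ring
  rw [jacobiSym.legendreSym.to_jacobiSym]
  rcases Int.natCast_natAbs_eq_or_eq_neg n with h | h
  · rw [h] at key
    rw [key]
    congr 2
    rw [← Int.cast_natCast, h]
  -- For negative n both sides change sign, since (-1/q) = χ₄(-1) = -1.
  · have hn' : n = -(n.natAbs : ℤ) := by omega
    have e : ((n : ℤ) : ZMod 4) = -1 * ((n.natAbs : ℕ) : ZMod 4) := by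
      rw [← Int.cast_natCast n.natAbs, h]
      push_cast; ring
    rw [e, map_mul, hn', jacobiSym.neg _ hqodd, ZMod.χ₄_nat_three_mod_four hq, key, Int.natAbs_neg,
      Int.natAbs_natCast]
    have : ZMod.χ₄ (-1) = -1 := by decide
    rw [this]; ring

theorem jacobiSym_two_natAbs {n : ℤ} (hn : Odd n) : J(2 | n.natAbs) = ZMod.χ₈ n := by
  rw [jacobiSym.at_two (Int.natAbs_odd.mpr hn)]
  rcases Int.natCast_natAbs_eq_or_eq_neg n with h | h
  · congr 1
    rw [← Int.cast_natCast, h]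
  · have e : ((n : ℤ) : ZMod 8) = -((n.natAbs : ℕ) : ZMod 8) := by
      have hn' : n = -(n.natAbs : ℤ) := by omega
      rw [← Int.cast_natCast n.natAbs, h]
      push_cast; ring
    rw [e]
    generalize ((n.natAbs : ℕ) : ZMod 8) = z
    revert z; decide

/-- The version of `jacobiSym_eq_one_of_mul_eq_sq_sub` for a signed odd integer. -/
theorem jacobiSym_natAbs_eq_one_of_mul_eq_sq_sub (D n k u w : ℤ) (hn : Odd n)
    (h : n * k = u ^ 2 - D * w ^ 2)
    (hprim : ∀ l : ℤ, Prime l → l ∣ n → l ∣ k → l ∣ u → l ∣ w → False)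
    (hD : IsCoprime D n) : J(D | n.natAbs) = 1 := by
  have hD' : D.gcd (n.natAbs : ℤ) = 1 := by
    rw [← Int.isCoprime_iff_gcd_eq_one]
    rcases Int.natCast_natAbs_eq_or_eq_neg n with h | h <;> rw [h]
    exacts [hD, hD.neg_right]
  rcases Int.natCast_natAbs_eq_or_eq_neg n with h1 | h1
  · refine jacobiSym_eq_one_of_mul_eq_sq_sub D _ (Int.natAbs_odd.mpr hn) k u w (by rw [h1, h]) ?_ hD'
    exact fun l hl hln => hprim l (Nat.prime_iff_prime_int.mp hl) (Int.natCast_dvd.mpr hln)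
  · refine jacobiSym_eq_one_of_mul_eq_sq_sub D _ (Int.natAbs_odd.mpr hn) (-k) u w
      (by rw [h1, ← h]; ring) ?_ hD'
    exact fun l hl hln hk => hprim l (Nat.prime_iff_prime_int.mp hl) (Int.natCast_dvd.mpr hln)
      ((dvd_neg).mp hk)

theorem χ₄_eq_one_or_neg_one {n : ℤ} (hn : Odd n) : ZMod.χ₄ n = 1 ∨ ZMod.χ₄ n = -1 := by
  rcases Int.odd_iff.mp hn |> (fun h => (by omega : n % 4 = 1 ∨ n % 4 = 3)) with h | h
  · exact .inl (ZMod.χ₄_int_one_mod_four h)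
  · exact .inr (ZMod.χ₄_int_three_mod_four h)

/-- If `n k = u² - q w²` with `n` odd and `q ∤ k`, then `(k / q) = χ₄ n`, even if `q ∣ n`. -/
theorem legendreSym_cofactor_eq_χ₄ {q : ℕ} [hqf : Fact q.Prime] (hq : q % 4 = 3) (N : ℕ) :
    ∀ n k u w : ℤ, n.natAbs = N → Odd n → ¬ (q : ℤ) ∣ k → n * k = u ^ 2 - q * w ^ 2 →
    (∀ l : ℤ, Prime l → l ∣ n → l ∣ k → l ∣ u → l ∣ w → False) →
    legendreSym q k = ZMod.χ₄ n := by
  have hqp : Prime (q : ℤ) := Nat.prime_iff_prime_int.mp hqf.out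
  have hq0 : (q : ℤ) ≠ 0 := hqp.ne_zero
  have hχq : ZMod.χ₄ ((q : ℤ) : ZMod 4) = -1 := by
    rw [Int.cast_natCast]; exact ZMod.χ₄_nat_three_mod_four hq
  induction N using Nat.strong_induction_on with
  | _ N ih =>
  intro n k u w hN hn hk h hprim
  have hk0 : ((k : ℤ) : ZMod q) ≠ 0 := by rwa [Ne, ZMod.intCast_zmod_eq_zero_iff_dvd] 
  -- If q ∣ n then q ∣ u, and dividing by q swaps u with w and negates k; the signs (-1/q) and
  -- χ₄(q), both -1, cancel. If q ∤ n, then (n/q)(k/q) = (u²/q) = 1 and reciprocity evaluates (n/q).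
  by_cases hqn : (q : ℤ) ∣ n
  · have hu : (q : ℤ) ∣ u := by
      apply hqp.dvd_of_dvd_pow (n := 2)
      have : u ^ 2 = n * k + q * w ^ 2 := by linarith
      rw [this]
      exact dvd_add (hqn.mul_right k) (Dvd.intro _ rfl)
    obtain ⟨n1, rfl⟩ := hqn
    obtain ⟨u1, rfl⟩ := hu
    have h1 : n1 * (-k) = w ^ 2 - q * u1 ^ 2 := by
      apply mul_left_cancel₀ hq0
      linear_combination -h
    have hn1 : Odd n1 := (Int.odd_mul.mp hn).2
    have hk' : ¬ (q : ℤ) ∣ -k := by rwa [dvd_neg]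
    have hlt : n1.natAbs < N := by
      rw [← hN, Int.natAbs_mul]
      have : 0 < n1.natAbs := Int.natAbs_pos.mpr (by rintro rfl; simp at hn1)
      have := hqf.out.two_le
      rw [Int.natAbs_natCast]
      nlinarith
    have := ih _ hlt n1 (-k) w u1 rfl hn1 hk' h1 (fun l hl ha hb hc hd =>
      hprim l hl (ha.mul_left _) ((dvd_neg).mp hb) (hd.mul_left _) hc)
    rw [neg_eq_neg_one_mul, legendreSym.mul, legendreSym.at_neg_one (by rintro rfl; omega),
      ZMod.χ₄_nat_three_mod_four hq] at this
    push_cast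
    rw [map_mul, ← Int.cast_natCast, hχq, ← this]; ring
  · have hn0 : ((n : ℤ) : ZMod q) ≠ 0 := by rwa [Ne, ZMod.intCast_zmod_eq_zero_iff_dvd]
    have hcop : IsCoprime (q : ℤ) n := (Prime.coprime_iff_not_dvd hqp).mpr hqn
    have hJ := jacobiSym_natAbs_eq_one_of_mul_eq_sq_sub q n k u w hn h hprim hcop
    have hL := legendreSym_eq_χ₄_mul_jacobiSym hq hn
    rw [hJ, mul_one] at hL
    have hu0 : ((u : ℤ) : ZMod q) ≠ 0 := by
      intro hu
      have : ((n * k : ℤ) : ZMod q) = 0 := by rw [h]; push_cast; rw [hu]; simp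
      rw [Int.cast_mul] at this
      exact (mul_ne_zero hn0 hk0) this
    have h1 : legendreSym q n * legendreSym q k = 1 := by
      rw [← legendreSym.mul, ← legendreSym.sq_one' q hu0, h, legendreSym.mod q (u ^ 2 - _),
        legendreSym.mod q (u ^ 2)]
      congr 1
      rw [sub_eq_add_neg, ← mul_neg, Int.add_mul_emod_self_left]
    rw [hL] at h1
    rcases χ₄_eq_one_or_neg_one hn with h2 | h2 <;> rw [h2] at h1 ⊢ <;> linarith

theorem Int.even_sq_add_sq_mod {p : ℕ} (hp : p % 8 = 1) {c d : ℤ} (hc : Odd c)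
    (h : (p : ℤ) = c ^ 2 + d ^ 2) : d % 4 = 0 := by
  have hc' : c ^ 2 % 8 = 1 := by
    have : c % 8 = 1 ∨ c % 8 = 3 ∨ c % 8 = 5 ∨ c % 8 = 7 := by
      have := Int.odd_iff.mp hc; omega
    rcases this with h | h | h | h <;> simp [pow_two, Int.mul_emod, h]
  have hd' : d ^ 2 % 8 = 0 := by omega
  have : d % 8 = 0 ∨ d % 8 = 1 ∨ d % 8 = 2 ∨ d % 8 = 3 ∨ d % 8 = 4 ∨ d % 8 = 5 ∨ d % 8 = 6 ∨
    d % 8 = 7 := by omega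
  rcases this with h | h | h | h | h | h | h | h <;> simp [pow_two, Int.mul_emod, h] at hd' <;> omega

/-- If a prime is represented as `a² + k b²`, then `a` and `b` have no common prime divisor. -/
theorem Nat.Prime.not_dvd_of_eq_sq_add {p : ℕ} (hp : p.Prime) {a b k : ℤ}
    (h : (p : ℤ) = a ^ 2 + k * b ^ 2) {l : ℤ} (hl : _root_.Prime l) (ha : l ∣ a) (hb : l ∣ b) : False := by
  obtain ⟨a, rfl⟩ := ha
  obtain ⟨b, rfl⟩ := hb
  have hpp := (Nat.prime_iff_prime_int.mp hp).irreducible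
  have h' : (p : ℤ) = l * (l * (a ^ 2 + k * b ^ 2)) := by rw [h]; ring
  rcases hpp.isUnit_or_isUnit h' with h1 | h1
  · exact hl.not_isUnit h1
  · exact hl.not_isUnit (isUnit_of_mul_isUnit_left h1)

/-- This supplies primitivity for factorisations such as (x+d)(x-d): a common prime divisor of both
factors divides their sum 2x, and oddness of one factor excludes 2. -/
theorem Prime.dvd_of_two_mul_eq_add {l n k x : ℤ} (hl : Prime l) (hn : Odd n) (hln : l ∣ n)
    (hk : l ∣ k) (h : 2 * x = n + k) : l ∣ x := by
  refine (hl.dvd_or_dvd (h ▸ dvd_add hln hk)).resolve_left fun h2 => hl.not_isUnit ?_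
  obtain ⟨m, rfl⟩ := hn
  exact isUnit_of_dvd_one ((dvd_add_right (h2.mul_right m)).mp hln)

theorem χ₈_eq_one_or_neg_one {n : ℤ} (hn : Odd n) : ZMod.χ₈ n = 1 ∨ ZMod.χ₈ n = -1 := by
  have := Int.odd_iff.mp hn
  rw [ZMod.χ₈_int_eq_if_mod_eight]
  split_ifs <;> omega

/-- The factorisation gives (2q/|n|) = 1, hence (q/|n|) = (2/|n|) = χ₈(n); reciprocity costs no sign
because n ≡ 1 mod 4. -/
theorem legendreSym_eq_χ₈_of_mul_eq_sq_sub {q : ℕ} [hqf : Fact q.Prime] (hq : q % 4 = 3)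
    {n k u w : ℤ} (hn : n % 4 = 1) (h : n * k = u ^ 2 - 2 * q * w ^ 2) (hqn : ¬ (q : ℤ) ∣ n)
    (hprim : ∀ l : ℤ, Prime l → l ∣ n → l ∣ k → l ∣ u → l ∣ w → False) :
    legendreSym q n = ZMod.χ₈ n := by
  have hodd : Odd n := Int.odd_iff.mpr (by omega)
  have hqp : Prime (q : ℤ) := Nat.prime_iff_prime_int.mp hqf.out
  have hcop : IsCoprime (2 * q : ℤ) n :=
    IsCoprime.mul_left (Int.isCoprime_iff_gcd_eq_one.mpr
      (by simpa [Int.gcd_comm] using Int.isCoprime_iff_gcd_eq_one.mp (Int.isCoprime_two_left.mpr hodd)))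
      ((Prime.coprime_iff_not_dvd hqp).mpr hqn)
  have hJ := jacobiSym_natAbs_eq_one_of_mul_eq_sq_sub (2 * q) n k u w hodd h hprim hcop
  rw [jacobiSym.mul_left, jacobiSym_two_natAbs hodd] at hJ
  rw [legendreSym_eq_χ₄_mul_jacobiSym hq hodd, ZMod.χ₄_int_one_mod_four hn, one_mul]
  rcases χ₈_eq_one_or_neg_one hodd with h1 | h1 <;> rw [h1] at hJ ⊢ <;> linarith

/-- The quadratic characters modulo `q` attached to the three representations
`p = c² + d² = x² + 2qy² = A² + 2B²` agree. -/
theorem exists_common_legendreSym {p q : ℕ} [hpf : Fact p.Prime] [hqf : Fact q.Prime]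
    (hp : p % 8 = 1) (hq : q % 8 = 7) {c d x y A B : ℤ}
    (hcd : (p : ℤ) = c ^ 2 + d ^ 2) (hxy : (p : ℤ) = x ^ 2 + 2 * q * y ^ 2)
    (hAB : (p : ℤ) = A ^ 2 + 2 * B ^ 2) (hc : Odd c) (hx : x % 4 = 1) (hA : A % 4 = 1) :
    ∃ e : ℤ, (e = 1 ∨ e = -1) ∧
      (¬ (q : ℤ) ∣ x + d → legendreSym q (x + d) = e) ∧
      (¬ (q : ℤ) ∣ x - d → legendreSym q (x - d) = e) ∧
      (¬ (q : ℤ) ∣ x + A → legendreSym q (x + A) = e) ∧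
      (¬ (q : ℤ) ∣ x - A → legendreSym q (x - A) = e) := by
  have hq4 : q % 4 = 3 := by omega
  have hqp : Prime (q : ℤ) := Nat.prime_iff_prime_int.mp hqf.out
  have hd : d % 4 = 0 := Int.even_sq_add_sq_mod hp hc hcd
  have primxy := fun {l : ℤ} => hpf.out.not_dvd_of_eq_sq_add (a := x) (b := y) (k := 2 * q) (l := l)
    (by rw [hxy])
  have primAB := fun {l : ℤ} => hpf.out.not_dvd_of_eq_sq_add (a := A) (b := B) (k := 2) (l := l)
    (by rw [hAB])
  have hoddxd : Odd (x + d) := Int.odd_iff.mpr (by omega)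
  have hoddxd' : Odd (x - d) := Int.odd_iff.mpr (by omega)
  have hoddAd : Odd (A + d) := Int.odd_iff.mpr (by omega)
  -- From (A+d)(A-d) = c² - 2B² one gets (2/|A+d|) = 1, so A+d ≡ ±1 mod 8, and A+d ≡ 1 mod 4 fixes
  -- the sign.
  have hAd : (A + d) % 8 = 1 := by
    have hJ := jacobiSym_natAbs_eq_one_of_mul_eq_sq_sub 2 (A + d) (A - d) c B hoddAd
      (by linear_combination hcd - hAB) (fun l hl h1 h2 _ h4 => primAB hl
        (hl.dvd_of_two_mul_eq_add hoddAd h1 h2 (by ring)) h4)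
      (Int.isCoprime_two_left.mpr hoddAd)
    rw [jacobiSym_two_natAbs hoddAd, ZMod.χ₈_int_eq_if_mod_eight] at hJ
    split_ifs at hJ <;> omega
  have hplus : ¬ (q : ℤ) ∣ x + d → legendreSym q (x + d) = ZMod.χ₈ ((x + d : ℤ) : ZMod 8) := fun h =>
    legendreSym_eq_χ₈_of_mul_eq_sq_sub (k := x - d) (u := c) (w := y) hq4 (by omega)
      (by linear_combination hcd - hxy) h (fun l hl h1 h2 _ h4 => primxy hl
        (hl.dvd_of_two_mul_eq_add hoddxd h1 h2 (by ring)) h4)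
  have hminus : ¬ (q : ℤ) ∣ x - d → legendreSym q (x - d) = ZMod.χ₈ ((x - d : ℤ) : ZMod 8) := fun h =>
    legendreSym_eq_χ₈_of_mul_eq_sq_sub (k := x + d) (u := c) (w := y) hq4 (by omega)
      (by linear_combination hcd - hxy) h (fun l hl h1 h2 _ h4 => primxy hl
        (hl.dvd_of_two_mul_eq_add hoddxd' h1 h2 (by ring)) h4)
  have hdd : ZMod.χ₈ ((x - d : ℤ) : ZMod 8) = ZMod.χ₈ ((x + d : ℤ) : ZMod 8) := by
    congr 1
    rw [ZMod.intCast_eq_intCast_iff']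
    omega
  obtain ⟨n, hn⟩ : ∃ n, x + A = 2 * n := ⟨(x + A) / 2, by omega⟩
  have hnodd : Odd n := Int.odd_iff.mpr (by omega)
  -- Modulo 8, A ≡ 1-d ≡ 1+d because 4 ∣ d, so 2n ≡ x+d+1: n is 1 or 3 mod 4 according as x+d is 1
  -- or 5 mod 8.
  have hχ : ZMod.χ₄ (n : ZMod 4) = ZMod.χ₈ ((x + d : ℤ) : ZMod 8) := by
    rw [ZMod.χ₄_int_eq_if_mod_four, ZMod.χ₈_int_eq_if_mod_eight]
    split_ifs <;> omega
  have hnk : n * (x - A) = B ^ 2 - q * y ^ 2 := by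
    have h2 : (2 : ℤ) * (n * (x - A)) = 2 * (B ^ 2 - q * y ^ 2) := by
      linear_combination (-(x - A)) * hn + hAB - hxy
    exact mul_left_cancel₀ two_ne_zero h2
  have hnprim : ∀ l : ℤ, Prime l → l ∣ n → l ∣ x - A → l ∣ B → l ∣ y → False :=
    fun l hl h1 h2 _ h4 => primxy hl (hl.dvd_of_two_mul_eq_add hnodd h1
      (dvd_add h1 h2) (by linear_combination hn)) h4
  have h2q : legendreSym q 2 = 1 := by
    rw [legendreSym.at_two (by rintro rfl; omega), ZMod.χ₈_nat_eq_if_mod_eight]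
    simp [hq]; omega
  refine ⟨ZMod.χ₈ ((x + d : ℤ) : ZMod 8), χ₈_eq_one_or_neg_one hoddxd, hplus,
    fun h => (hminus h).trans hdd, fun h => ?_, fun h => ?_⟩
  · have hqn : ¬ (q : ℤ) ∣ n := fun h' => h (hn ▸ h'.mul_left 2)
    rw [hn, legendreSym.mul, h2q, one_mul, legendreSym_eq_χ₄_mul_jacobiSym hq4 hnodd,
      jacobiSym_natAbs_eq_one_of_mul_eq_sq_sub q n (x - A) B y hnodd hnk hnprim
        ((Prime.coprime_iff_not_dvd hqp).mpr hqn), mul_one, hχ]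
  -- Here q may divide n, so reciprocity for n alone does not suffice.
  · rw [← hχ]
    exact legendreSym_cofactor_eq_χ₄ hq4 _ n (x - A) B y rfl hnodd h hnk hnprim

open Polynomial

/-! ### Two identities between Jacobi sums over a finite field. -/

section JacobiSum

variable {F R : Type*} [Field F] [Fintype F] [CommRing R]

/-- `χ(4) J(χ, χ) = J(χ, φ)` for the quadratic character `φ`. -/
theorem jacobiSum_self_mul_apply_four [DecidableEq F] [IsDomain R] (hF : ringChar F ≠ 2)
    {χ : MulChar F R} (hχ : χ ≠ 1) :
    χ 4 * jacobiSum χ χ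
      = jacobiSum χ ((quadraticChar F).ringHomComp (Int.castRingHom R)) := by
  have h2 : (2 : F) ≠ 0 := Ring.two_ne_zero hF
  -- Completing the square: 4x(1-x) = 1 - (2x-1)². Grouping by the value t of the square then gives
  -- weight 1 + φ(t).
  have e1 : χ 4 * jacobiSum χ χ = ∑ x : F, χ (1 - x ^ 2) := by
    rw [jacobiSum, Finset.mul_sum]
    refine Fintype.sum_equiv ((Equiv.mulLeft₀ 2 h2).trans (Equiv.subRight 1)) _ _ fun x => ?_
    rw [← map_mul, ← map_mul]
    congr 1
    change 4 * (x * (1 - x)) = 1 - (2 * x - 1) ^ 2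
    ring
  have e2 : ∑ x : F, χ (1 - x ^ 2) = ∑ t : F, ((quadraticChar F t + 1 : ℤ) : R) * χ (1 - t) := by
    rw [← Finset.sum_fiberwise Finset.univ (fun x : F => x ^ 2)]
    refine Finset.sum_congr rfl fun t _ => ?_
    rw [← quadraticChar_card_sqrts hF t, Finset.sum_congr rfl (g := fun _ => χ (1 - t))
      (fun x hx => by rw [(Finset.mem_filter.mp hx).2]), Finset.sum_const, nsmul_eq_mul,
      Int.cast_natCast]
    congr 3
    ext x
    simp
  have e3 : ∑ t : F, χ (1 - t) = 0 := by
    rw [← MulChar.sum_eq_zero_of_ne_one hχ]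
    exact Fintype.sum_equiv (Equiv.subLeft 1) _ _ fun x => rfl
  rw [e1, e2, jacobiSum_comm, jacobiSum]
  simp only [Int.cast_add, Int.cast_one, add_mul, one_mul, Finset.sum_add_distrib, e3, add_zero]
  rfl

/-- The substitution `x ↦ x / (x - 1)` in a Jacobi sum. -/
theorem jacobiSum_eq_apply_neg_one_mul {χ ψ ψ' : MulChar F R} (h : χ * ψ * ψ' = 1) :
    jacobiSum χ ψ = χ (-1) * jacobiSum χ ψ' := by
  classical
  -- The term at x = 1 vanishes, and x ↦ x/(x-1) is an involution of the remaining elements.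
  have key : ∀ θ : MulChar F R, jacobiSum χ θ = ∑ x ∈ Finset.univ.erase 1, χ x * θ (1 - x) := by
    intro θ
    rw [jacobiSum, ← Finset.add_sum_erase _ _ (Finset.mem_univ (1 : F)), sub_self,
      MulChar.map_zero, mul_zero, zero_add]
  rw [key, key, Finset.mul_sum]
  refine Finset.sum_nbij' (fun x => x / (x - 1)) (fun x => x / (x - 1)) ?_ ?_ ?_ ?_ ?_
  · intro x hx
    have hx1 : x - 1 ≠ 0 := sub_ne_zero.mpr (Finset.ne_of_mem_erase hx)
    refine Finset.mem_erase.mpr ⟨fun h => ?_, Finset.mem_univ _⟩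
    rw [div_eq_one_iff_eq hx1] at h
    exact one_ne_zero (α := F) (by linear_combination h)
  · intro x hx
    have hx1 : x - 1 ≠ 0 := sub_ne_zero.mpr (Finset.ne_of_mem_erase hx)
    refine Finset.mem_erase.mpr ⟨fun h => ?_, Finset.mem_univ _⟩
    rw [div_eq_one_iff_eq hx1] at h
    exact one_ne_zero (α := F) (by linear_combination h)
  · intro x hx
    have hx1 : x - 1 ≠ 0 := sub_ne_zero.mpr (Finset.ne_of_mem_erase hx)
    have : x / (x - 1) - 1 = 1 / (x - 1) := by field_simp; ring
    simp only [this]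
    field_simp
  · intro x hx
    have hx1 : x - 1 ≠ 0 := sub_ne_zero.mpr (Finset.ne_of_mem_erase hx)
    have : x / (x - 1) - 1 = 1 / (x - 1) := by field_simp; ring
    simp only [this]
    field_simp
  · intro x hx
    have hx1 : 1 - x ≠ 0 := sub_ne_zero.mpr (Finset.ne_of_mem_erase hx).symm
    have hx1' : x - 1 ≠ 0 := sub_ne_zero.mpr (Finset.ne_of_mem_erase hx)
    have e1 : 1 - x / (x - 1) = (1 - x)⁻¹ := by
      field_simp
      ring
    have e2 : x = -1 * (x / (x - 1)) * (1 - x) := by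
      field_simp
      ring
    have e3 : ψ (1 - x) * χ (1 - x) * ψ' (1 - x) = 1 := by
      rw [mul_comm (ψ _), ← MulChar.mul_apply, ← MulChar.mul_apply, h,
        MulChar.one_apply (isUnit_iff_ne_zero.mpr hx1)]
    have e4 : ψ' (1 - x) * ψ' (1 - x)⁻¹ = 1 := by
      rw [← map_mul, mul_inv_cancel₀ hx1, map_one]
    have e5 : χ x = χ (-1) * χ (x / (x - 1)) * χ (1 - x) := by
      conv_lhs => rw [e2]
      simp only [map_mul]
    rw [e1, e5]
    linear_combination (χ (-1) * χ (x / (x - 1)) * ψ' (1 - x)⁻¹) * e3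
      - χ (-1) * χ (x / (x - 1)) * ψ (1 - x) * χ (1 - x) * e4

end JacobiSum

/-! ### The ring ℤ[ζ₈] and its power basis. -/

section EighthRoots

theorem X_pow_four_add_one_eq_cyclotomic : (X ^ 4 + 1 : ℤ[X]) = cyclotomic 8 ℤ := by
  have := cyclotomic_prime_pow_eq_geom_sum (R := ℤ) (n := 2) Nat.prime_two
  norm_num [Finset.sum_range_succ] at this
  rw [this, add_comm]

theorem prime_X_pow_four_add_one : Prime (X ^ 4 + 1 : ℤ[X]) := by
  rw [X_pow_four_add_one_eq_cyclotomic]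
  exact (cyclotomic.irreducible (by norm_num)).prime

theorem natDegree_X_pow_four_add_one : (X ^ 4 + 1 : ℤ[X]).natDegree = 4 := by
  compute_degree!

/-- The ring `ℤ[ζ₈]` of integers of the eighth cyclotomic field. -/
abbrev ZetaEight : Type := AdjoinRoot (X ^ 4 + 1 : ℤ[X])

namespace ZetaEight

instance : IsDomain ZetaEight := AdjoinRoot.isDomain_of_prime prime_X_pow_four_add_one

/-- The generating eighth root of unity. -/
noncomputable abbrev ζ : ZetaEight := AdjoinRoot.root (X ^ 4 + 1 : ℤ[X])

theorem ζ_pow_four : ζ ^ 4 = -1 := by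
  have := AdjoinRoot.eval₂_root (X ^ 4 + 1 : ℤ[X])
  simp only [eval₂_add, eval₂_pow, eval₂_X, eval₂_one] at this
  exact eq_neg_of_add_eq_zero_left this

theorem exists_rep (s : ZetaEight) :
    ∃ a b c d : ℤ, s = a + b * ζ + c * ζ ^ 2 + d * ζ ^ 3 := by
  induction s using AdjoinRoot.induction_on with
  | _ P =>
  induction P using Polynomial.induction_on with
  | C a => exact ⟨a, 0, 0, 0, by simp⟩
  | add P Q hP hQ =>
    obtain ⟨a, b, c, d, h⟩ := hP
    obtain ⟨a', b', c', d', h'⟩ := hQ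
    refine ⟨a + a', b + b', c + c', d + d', ?_⟩
    rw [map_add, h, h']
    push_cast
    ring
  | monomial n k h =>
    obtain ⟨a, b, c, d, h⟩ := h
    refine ⟨-d, a, b, c, ?_⟩
    rw [show C k * X ^ (n + 1) = C k * X ^ n * X by ring, map_mul, h, AdjoinRoot.mk_X]
    push_cast
    linear_combination (d : ZetaEight) * ζ_pow_four

theorem eq_zero_of_rep {a b c d : ℤ}
    (h : (a : ZetaEight) + b * ζ + c * ζ ^ 2 + d * ζ ^ 3 = 0) : a = 0 ∧ b = 0 ∧ c = 0 ∧ d = 0 := by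
  set P : ℤ[X] := C a + C b * X + C c * X ^ 2 + C d * X ^ 3 with hP
  have h1 : AdjoinRoot.mk (X ^ 4 + 1 : ℤ[X]) P = 0 := by
    rw [hP]
    simpa using h
  have h2 : P = 0 := by
    refine eq_zero_of_dvd_of_natDegree_lt (AdjoinRoot.mk_eq_zero.mp h1) ?_
    rw [natDegree_X_pow_four_add_one]
    refine lt_of_le_of_lt (b := 3) ?_ (by norm_num)
    rw [hP]
    compute_degree
  have hc : ∀ n, P.coeff n = 0 := fun n => by rw [h2, coeff_zero]
  have h0 := hc 0
  have h1 := hc 1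
  have h2 := hc 2
  have h3 := hc 3
  simp [-eq_intCast, hP, coeff_X, coeff_C] at h0 h1 h2 h3
  exact ⟨h0, h1, h2, h3⟩

theorem intCast_inj {a b : ℤ} (h : (a : ZetaEight) = b) : a = b := by
  have := eq_zero_of_rep (a := a - b) (b := 0) (c := 0) (d := 0) (by push_cast; rw [h]; ring)
  omega

instance : CharZero ZetaEight := ⟨fun a b h => by
  have := intCast_inj (a := a) (b := b) (by exact_mod_cast h)
  exact_mod_cast this⟩

/-- The ring homomorphism sending `ζ` to a given primitive eighth root of unity. -/
noncomputable def lift {R : Type*} [CommRing R] (z : R) (hz : z ^ 4 = -1) : ZetaEight →+* R :=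
  AdjoinRoot.lift (Int.castRingHom R) z (by simp [hz])

@[simp]
theorem lift_ζ {R : Type*} [CommRing R] (z : R) (hz : z ^ 4 = -1) : lift z hz ζ = z :=
  AdjoinRoot.lift_root _

end ZetaEight

end EighthRoots

/-! ### Octic characters given by their value at a generator. -/

section CyclicCharacters

theorem FiniteField.sum_eval_eq_zero {F : Type*} [Field F] [Fintype F] (P : F[X])
    (hP : P.natDegree < Fintype.card F - 1) : ∑ x : F, P.eval x = 0 := by
  simp only [eval_eq_sum_range]
  rw [Finset.sum_comm]
  refine Finset.sum_eq_zero fun i hi => ?_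
  rw [← Finset.mul_sum, FiniteField.sum_pow_lt_card_sub_one, mul_zero]
  have := Finset.mem_range.mp hi
  omega

variable {p e : ℕ} [hpf : Fact p.Prime] {g : (ZMod p)ˣ} {R : Type*} [CommRing R]

theorem exists_mulChar_apply_generator (hg : ∀ x, x ∈ Subgroup.zpowers g) (hp : p = 8 * e + 1)
    {z : R} (hz : z ^ 4 = -1) : ∃ χ : MulChar (ZMod p) R, χ g = z := by
  have h8 : z ^ 8 = 1 := by
    rw [show z ^ 8 = (z ^ 4) ^ 2 by ring, hz]; ring
  have hu : IsUnit z := IsUnit.of_pow_eq_one h8 (by norm_num)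
  have hmem : hu.unit ∈ rootsOfUnity (Fintype.card (ZMod p)ˣ) R := by
    rw [mem_rootsOfUnity]
    ext
    rw [ZMod.card_units, hp]
    simp [pow_mul, h8]
  exact ⟨MulChar.ofRootOfUnity hmem hg, by rw [MulChar.ofRootOfUnity_spec]; rfl⟩

theorem MulChar.pow_four_eq_quadraticChar (hg : ∀ x, x ∈ Subgroup.zpowers g)
    (hp : p = 8 * e + 1) {χ : MulChar (ZMod p) R} (h : χ g ^ 4 = -1) :
    χ ^ 4 = (quadraticChar (ZMod p)).ringHomComp (Int.castRingHom R) := by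
  rw [MulChar.eq_iff hg, MulChar.pow_apply_coe, h, MulChar.ringHomComp_apply]
  have h2 : ringChar (ZMod p) ≠ 2 := by
    rw [ZMod.ringChar_zmod_n]
    rintro rfl
    omega
  have hne : quadraticChar (ZMod p) g ≠ 1 := fun h1 =>
    quadraticChar_ne_one h2 ((MulChar.eq_iff hg _ _).mpr (by simpa using h1))
  rcases quadraticChar_dichotomy (F := ZMod p) g.ne_zero with h1 | h1
  · exact absurd h1 hne
  · rw [h1]; simp

end CyclicCharacters

/-! ### Evaluation of the octic Jacobi sums. -/

section OcticJacobi

variable {p e : ℕ} [hpf : Fact p.Prime] {g : (ZMod p)ˣ}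

/-- Characters composed with ring homomorphisms are determined by the value at a generator. -/
theorem MulChar.eq_ringHomComp (hg : ∀ x, x ∈ Subgroup.zpowers g) {R R' : Type*} [CommRing R]
    [CommRing R'] {χ : MulChar (ZMod p) R} {χ' : MulChar (ZMod p) R'} (f : R →+* R')
    (h : f (χ g) = χ' g) : χ' = χ.ringHomComp f := by
  rw [MulChar.eq_iff hg, MulChar.ringHomComp_apply, h]

theorem MulChar.apply_eq_pow_of_apply_generator (hg : ∀ x, x ∈ Subgroup.zpowers g) {n : ℕ}
    (hn : n ≠ 0) {χ : MulChar (ZMod p) (ZMod p)} (h : χ g = (g : ZMod p) ^ n) (x : ZMod p) :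
    χ x = x ^ n := by
  rcases eq_or_ne x 0 with rfl | hx
  · rw [MulChar.map_zero, zero_pow hn]
  obtain ⟨k, hk⟩ := mem_powers_iff_mem_zpowers.mpr (hg (Units.mk0 x hx))
  have : x = (g : ZMod p) ^ k := by
    rw [← Units.val_pow_eq_pow_val]
    exact (congrArg Units.val hk).symm
  rw [this, map_pow, h, ← pow_mul, ← pow_mul, mul_comm]

theorem generator_pow_eq_neg_one (hg : ∀ x, x ∈ Subgroup.zpowers g) (hp : p = 8 * e + 1) :
    ((g : ZMod p) ^ e) ^ 4 = -1 := by
  have hprime := hpf.out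
  have he : 0 < e := by
    rcases Nat.eq_zero_or_pos e with rfl | h
    · rw [hp] at hprime; norm_num at hprime
    · exact h
  have hord : orderOf g = 8 * e := by
    rw [orderOf_eq_card_of_forall_mem_zpowers hg, Nat.card_eq_fintype_card, ZMod.card_units, hp]
    rfl
  have h1 : ((g : ZMod p) ^ (4 * e)) ^ 2 = 1 := by
    rw [← pow_mul, ← Units.val_pow_eq_pow_val, show 4 * e * 2 = orderOf g by rw [hord]; ring,
      pow_orderOf_eq_one, Units.val_one]
  rw [← pow_mul, mul_comm]
  rcases mul_self_eq_one_iff.mp ((sq _).symm.trans h1) with h2 | h2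
  · exfalso
    have : g ^ (4 * e) = 1 := by
      ext
      rw [Units.val_pow_eq_pow_val, h2, Units.val_one]
    have := Nat.le_of_dvd (by omega) (orderOf_dvd_of_pow_eq_one this)
    omega
  · exact h2

open ZetaEight in
/-- The Jacobi sums `J(χ, χ⁴)` and `J(χ², χ⁴)` of an octic character `χ`, evaluated in `ℤ[ζ₈]`. -/
theorem ZetaEight.exists_jacobiSum_eq (hg : ∀ x, x ∈ Subgroup.zpowers g) (hp : p = 8 * e + 1)
    {χ : MulChar (ZMod p) ZetaEight} (hχ : χ g = ζ) :
    ∃ A B a b : ℤ, A ^ 2 + 2 * B ^ 2 = p ∧ a ^ 2 + b ^ 2 = p ∧ Odd a ∧ Even b ∧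
      (a : ZMod p) + b * ((g : ZMod p) ^ e) ^ 2 = 0 ∧
      jacobiSum χ (χ ^ 4) = A + B * (ζ + ζ ^ 3) ∧ jacobiSum (χ ^ 2) (χ ^ 4) = a + b * ζ ^ 2 := by
  have h4 : ζ ^ 4 = -1 := ζ_pow_four
  have hpow : ∀ n : ℕ, (χ ^ n) g = ζ ^ n := fun n => by
    rw [MulChar.pow_apply_coe, hχ]
  have hinv : ∀ m n : ℕ, ζ ^ m = ζ ^ n → χ ^ m = χ ^ n := fun m n h => by
    rw [MulChar.eq_iff hg, hpow, hpow, h]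
  have h8 : χ ^ 8 = 1 := by
    rw [← pow_zero χ]; exact hinv _ _ (by linear_combination (ζ ^ 4 - 1) * h4)
  have hnot : ∀ n : ℕ, (ζ ^ n) ^ 4 = -1 ∨ (ζ ^ n) ^ 2 = -1 ∨ ζ ^ n = -1 → χ ^ n ≠ 1 := by
    intro n h h1
    have h2 := hpow n
    rw [h1, MulChar.one_apply_coe] at h2
    rw [← h2] at h
    norm_num at h
  -- the automorphisms of `ℤ[ζ₈]`
  have hσ : ∀ (j : ℕ) (hj : (ζ ^ j) ^ 4 = -1) (m n : ℕ), jacobiSum (χ ^ (j * m)) (χ ^ (j * n)) =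
      lift (ζ ^ j) hj (jacobiSum (χ ^ m) (χ ^ n)) := by
    intro j hj m n
    have : χ ^ j = χ.ringHomComp (lift (ζ ^ j) hj) :=
      MulChar.eq_ringHomComp hg _ (by rw [hpow, hχ, lift_ζ])
    rw [pow_mul, pow_mul, this, MulChar.ringHomComp_pow, MulChar.ringHomComp_pow,
      jacobiSum_ringHomComp]
  have hj3 : (ζ ^ 3) ^ 4 = -1 := by linear_combination (ζ ^ 8 - ζ ^ 4 + 1) * h4
  have hj5 : (ζ ^ 5) ^ 4 = -1 := by
    linear_combination (ζ ^ 16 - ζ ^ 12 + ζ ^ 8 - ζ ^ 4 + 1) * h4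
  have hj7 : (ζ ^ 7) ^ 4 = -1 := by
    linear_combination (ζ ^ 24 - ζ ^ 20 + ζ ^ 16 - ζ ^ 12 + ζ ^ 8 - ζ ^ 4 + 1) * h4
  have hlift : ∀ (j : ℕ) (hj : (ζ ^ j) ^ 4 = -1) (a b c d : ℤ),
      lift (ζ ^ j) hj (a + b * ζ + c * ζ ^ 2 + d * ζ ^ 3) =
        a + b * ζ ^ j + c * (ζ ^ j) ^ 2 + d * (ζ ^ j) ^ 3 := by
    intro j hj a b c d
    simp only [map_add, map_mul, map_intCast, map_pow, lift_ζ]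
  -- norms
  have hnorm : ∀ m n : ℕ, χ ^ m ≠ 1 → χ ^ n ≠ 1 → χ ^ (m + n) ≠ 1 →
      jacobiSum (χ ^ m) (χ ^ n) * jacobiSum (χ ^ (7 * m)) (χ ^ (7 * n)) = (p : ZetaEight) := by
    intro m n hm hn hmn
    -- The norm formula for Jacobi sums is applied with values in a field, then pulled back by
    -- injectivity.
    let f := algebraMap ZetaEight (FractionRing ZetaEight)
    have hf : Function.Injective f := IsFractionRing.injective _ _
    have i7 : ∀ m : ℕ, χ ^ (7 * m) = (χ ^ m)⁻¹ := fun m => by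
      rw [eq_inv_iff_mul_eq_one, ← pow_add, show 7 * m + m = 8 * m by ring, pow_mul, h8, one_pow]
    apply hf
    have h0 : ringChar (FractionRing ZetaEight) ≠ ringChar (ZMod p) := by
      rw [ZMod.ringChar_zmod_n, ringChar.eq_zero]
      exact hpf.out.ne_zero.symm
    have := jacobiSum_mul_jacobiSum_inv h0 (χ := (χ ^ m).ringHomComp f)
      (φ := (χ ^ n).ringHomComp f) ((MulChar.ringHomComp_ne_one_iff hf).mpr hm)
      ((MulChar.ringHomComp_ne_one_iff hf).mpr hn)
      (by rw [← MulChar.ringHomComp_mul, ← pow_add]; exact (MulChar.ringHomComp_ne_one_iff hf).mpr hmn)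
    rw [MulChar.ringHomComp_inv, MulChar.ringHomComp_inv, jacobiSum_ringHomComp,
      jacobiSum_ringHomComp, ZMod.card] at this
    rw [i7, i7, map_mul, this, map_natCast]
  obtain ⟨A, B, C, D, hJ⟩ := exists_rep (jacobiSum (χ ^ 1) (χ ^ 4))
  obtain ⟨a, b', b, d', hJ2⟩ := exists_rep (jacobiSum (χ ^ 2) (χ ^ 4))
  -- `J(χ, χ⁴) = J(χ³, χ⁴)`
  have hcube : jacobiSum (χ ^ (3 * 1)) (χ ^ (3 * 4)) = jacobiSum (χ ^ 1) (χ ^ 4) := by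
    have c12 : χ ^ (3 * 4) = χ ^ 4 := hinv _ _ (by linear_combination (ζ ^ 8 - ζ ^ 4) * h4)
    have s1 : jacobiSum (χ ^ 1) (χ ^ 4) = (χ ^ 1) (-1) * jacobiSum (χ ^ 1) (χ ^ 3) :=
      jacobiSum_eq_apply_neg_one_mul (by rw [← pow_add, ← pow_add, h8])
    have s3 : jacobiSum (χ ^ 3) (χ ^ 4) = (χ ^ 3) (-1) * jacobiSum (χ ^ 3) (χ ^ 1) :=
      jacobiSum_eq_apply_neg_one_mul (by rw [← pow_add, ← pow_add, h8])
    have hm : (χ ^ 3) (-1) = (χ ^ 1) (-1) := by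
      rw [MulChar.pow_apply' _ (by norm_num), MulChar.pow_apply' _ (by norm_num), pow_succ, ← map_pow]
      norm_num
    rw [c12, mul_one, s3, s1, hm, jacobiSum_comm]
  -- The substitution ζ ↦ ζ³ swaps the coefficients of ζ and ζ³ and negates that of ζ², so the sum
  -- lies in ℤ[√-2] with √-2 = ζ + ζ³.
  obtain ⟨-, hBD, hC, -⟩ : (0 : ℤ) = 0 ∧ B - D = 0 ∧ 2 * C = 0 ∧ D - B = 0 := by
    apply eq_zero_of_rep
    rw [hσ 3 hj3, hJ, hlift] at hcube
    push_cast
    linear_combination -hcube + (C * ζ ^ 2 + D * ζ * (ζ ^ 4 - 1)) * h4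
  have hD : D = B := by omega
  have hC : C = 0 := by omega
  subst hD hC
  -- `J(χ², χ⁴)` is fixed by `ζ ↦ ζ⁵`
  have hfive : jacobiSum (χ ^ (5 * 2)) (χ ^ (5 * 4)) = jacobiSum (χ ^ 2) (χ ^ 4) := by
    rw [hinv (5 * 2) 2 (by linear_combination (ζ ^ 6 - ζ ^ 2) * h4),
      hinv (5 * 4) 4 (by linear_combination (ζ ^ 16 - ζ ^ 12 + ζ ^ 8 - ζ ^ 4) * h4)]
  -- As ζ⁵ = -ζ, the odd coefficients vanish and the sum lies in ℤ[i].
  obtain ⟨-, hb', -, hd'⟩ : (0 : ℤ) = 0 ∧ 2 * b' = 0 ∧ (0 : ℤ) = 0 ∧ 2 * d' = 0 := by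
    apply eq_zero_of_rep
    rw [hσ 5 hj5, hJ2, hlift] at hfive
    push_cast
    linear_combination -hfive + (b' * ζ + b * (ζ ^ 6 - ζ ^ 2)
      + d' * (ζ ^ 11 - ζ ^ 7 + ζ ^ 3)) * h4
  have hb' : b' = 0 := by omega
  have hd' : d' = 0 := by omega
  subst hb' hd'
  simp only [Int.cast_zero, zero_mul, add_zero] at hJ hJ2
  have e7 : ζ ^ 7 = -ζ ^ 3 := by linear_combination ζ ^ 3 * h4
  refine ⟨A, D, a, b, ?_, ?_, ?_⟩
  · have h := hnorm 1 4 (hnot 1 (.inl (by rw [pow_one, h4]))) (hnot 4 (.inr (.inr h4)))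
      (hnot 5 (.inl hj5))
    rw [hσ 7 hj7, hJ] at h
    have h' := hlift 7 hj7 A D 0 D
    simp only [Int.cast_zero, zero_mul, add_zero] at h'
    rw [h', e7, show (-ζ ^ 3) ^ 3 = -ζ by linear_combination (-ζ ^ 5 + ζ) * h4] at h
    apply intCast_inj
    push_cast
    linear_combination h + (D ^ 2 * (2 + ζ ^ 2)) * h4
  · have h := hnorm 2 4 (hnot 2 (.inr (.inl (by rw [← pow_mul, h4])))) (hnot 4 (.inr (.inr h4)))
      (hnot 6 (.inr (.inl (by rw [← pow_mul]; linear_combination (ζ ^ 8 - ζ ^ 4 + 1) * h4))))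
    rw [hσ 7 hj7, hJ2] at h
    have h' := hlift 7 hj7 a 0 b 0
    simp only [Int.cast_zero, zero_mul, add_zero] at h'
    rw [h', e7] at h
    apply intCast_inj
    push_cast
    linear_combination h + (b ^ 2 * (1 - ζ ^ 4) - a * b * ζ ^ 2) * h4
  · have hquad : χ ^ 4 = (quadraticChar (ZMod p)).ringHomComp (Int.castRingHom ZetaEight) :=
      MulChar.pow_four_eq_quadraticChar hg hp (by rw [hχ, h4])
    have hsum : ∑ x : ZMod p, (χ ^ 2) x = 0 :=
      MulChar.sum_eq_zero_of_ne_one (hnot 2 (.inr (.inl (by rw [← pow_mul, h4]))))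
    rw [← Finset.add_sum_erase _ _ (Finset.mem_univ (1 : ZMod p)), map_one] at hsum
    -- Since χ² sums to -1 over x ≠ 1, J + 1 is a combination of the values χ⁴(1-x) - 1, each 0 or
    -- -2. This gives the parities of a and b.
    have hdvd : (2 : ZetaEight) ∣ jacobiSum (χ ^ 2) (χ ^ 4) + 1 := by
      have : jacobiSum (χ ^ 2) (χ ^ 4) + 1 =
          ∑ x ∈ Finset.univ.erase 1, (χ ^ 2) x * ((χ ^ 4) (1 - x) - 1) := by
        simp only [mul_sub, Finset.sum_sub_distrib, mul_one]
        rw [jacobiSum, ← Finset.add_sum_erase _ _ (Finset.mem_univ (1 : ZMod p)), sub_self,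
          MulChar.map_zero, mul_zero]
        linear_combination hsum
      rw [this]
      refine Finset.dvd_sum fun x hx => Dvd.dvd.mul_left ?_ _
      have hx1 : 1 - x ≠ 0 := sub_ne_zero.mpr (Finset.ne_of_mem_erase hx).symm
      rw [hquad, MulChar.ringHomComp_apply]
      rcases quadraticChar_dichotomy hx1 with h | h <;> rw [h]
      · simp
      · exact ⟨-1, by norm_num⟩
    obtain ⟨s, hs⟩ := hdvd
    obtain ⟨s0, s1, s2, s3, rfl⟩ := exists_rep s
    obtain ⟨ha, -, hb, -⟩ : a + 1 - 2 * s0 = 0 ∧ -2 * s1 = 0 ∧ b - 2 * s2 = 0 ∧ -2 * s3 = 0 := by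
      apply eq_zero_of_rep
      rw [hJ2] at hs
      push_cast
      linear_combination hs
    refine ⟨⟨s0 - 1, by omega⟩, ⟨s2, by omega⟩, ?_, ?_, ?_⟩
    · have hz := generator_pow_eq_neg_one hg hp
      set f := lift ((g : ZMod p) ^ e) hz with hf
      have he : e ≠ 0 := by
        rintro rfl
        exact hpf.out.one_lt.ne' hp
      have hval : ∀ x, (χ.ringHomComp f) x = x ^ e := fun x =>
        MulChar.apply_eq_pow_of_apply_generator hg he
          (by rw [MulChar.ringHomComp_apply, hχ, hf, lift_ζ]) x
      -- Under ζ ↦ g^e the character becomes x ↦ x^e, so the Jacobi sum becomes a sum over 𝔽_p of a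
      -- polynomial of degree at most 6e < p - 1 = 8e, which is zero.
      have h0 : f (jacobiSum (χ ^ 2) (χ ^ 4)) = 0 := by
        rw [← jacobiSum_ringHomComp, ← MulChar.ringHomComp_pow, ← MulChar.ringHomComp_pow,
          jacobiSum]
        rw [← FiniteField.sum_eval_eq_zero ((X ^ e) ^ 2 * ((1 - X) ^ e) ^ 4 : (ZMod p)[X]) ?_]
        · refine Finset.sum_congr rfl fun x _ => ?_
          rw [MulChar.pow_apply' _ (by norm_num), MulChar.pow_apply' _ (by norm_num), hval, hval]
          simp
        · have : ((X ^ e) ^ 2 * ((1 - X) ^ e) ^ 4 : (ZMod p)[X]).natDegree ≤ e * 2 + e * 4 := by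
            rw [← pow_mul, ← pow_mul]
            compute_degree
          rw [ZMod.card]
          omega
      rw [hJ2] at h0
      simpa only [map_add, map_mul, map_intCast, map_pow, hf, lift_ζ] using h0
    · rw [pow_one] at hJ
      rw [hJ]; ring
    · exact hJ2

/-- The Jacobi sums `J(χ, χ⁴)` and `J(χ², χ⁴)` of an octic character modulo `p`, with values in
any commutative ring. The integers `A, B, a, b` depend only on the chosen generator. -/
theorem exists_jacobiSum_octic_eq (hg : ∀ x, x ∈ Subgroup.zpowers g) (hp : p = 8 * e + 1) :
    ∃ A B a b : ℤ, A ^ 2 + 2 * B ^ 2 = p ∧ a ^ 2 + b ^ 2 = p ∧ Odd a ∧ Even b ∧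
      (a : ZMod p) + b * ((g : ZMod p) ^ e) ^ 2 = 0 ∧
      ∀ (R : Type) [CommRing R] (z : R) (χ : MulChar (ZMod p) R), z ^ 4 = -1 → χ g = z →
        jacobiSum χ (χ ^ 4) = A + B * (z + z ^ 3) ∧ jacobiSum (χ ^ 2) (χ ^ 4) = a + b * z ^ 2 := by
  obtain ⟨χ₀, hχ₀⟩ := exists_mulChar_apply_generator hg hp ZetaEight.ζ_pow_four
  obtain ⟨A, B, a, b, h1, h2, h3, h4, h5, hA, ha⟩ := ZetaEight.exists_jacobiSum_eq hg hp hχ₀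
  refine ⟨A, B, a, b, h1, h2, h3, h4, h5, fun R _ z χ hz hχ => ?_⟩
  have : χ = χ₀.ringHomComp (ZetaEight.lift z hz) :=
    MulChar.eq_ringHomComp hg _ (by rw [hχ₀, hχ, ZetaEight.lift_ζ])
  rw [this, MulChar.ringHomComp_pow, MulChar.ringHomComp_pow, jacobiSum_ringHomComp,
    jacobiSum_ringHomComp, hA, ha]
  simp only [map_add, map_mul, map_intCast, map_pow, ZetaEight.lift_ζ, and_self]

end OcticJacobi

/-! ### Gauss sums and Frobenius in characteristic q. -/

section GaussSum

theorem CharP.two_ne_zero_of_mod_eight {q : ℕ} {K : Type*} [Field K] [CharP K q] (hq : q % 8 = 7) : (2 : K) ≠ 0 := by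
  intro h
  have h2 : q ∣ 2 := (CharP.cast_eq_zero_iff K q 2).mp (by exact_mod_cast h)
  have := Nat.le_of_dvd (by norm_num) h2
  omega

variable {p e q : ℕ} [hpf : Fact p.Prime] {g : (ZMod p)ˣ} {K : Type*} [Field K] [CharP K q]

theorem MulChar.pow_ne_one_of_apply_generator {χ : MulChar (ZMod p) K} (hq : q % 8 = 7) {n : ℕ}
    (h : (χ g ^ n) ^ 4 = -1 ∨ (χ g ^ n) ^ 2 = -1 ∨ χ g ^ n = -1) : χ ^ n ≠ 1 := by
  intro h1
  have h2 : (χ ^ n) g = χ g ^ n := by rw [MulChar.pow_apply_coe]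
  rw [h1, MulChar.one_apply_coe] at h2
  rw [← h2] at h
  have h3 : (1 : K) = -1 := by simpa using h
  exact CharP.two_ne_zero_of_mod_eight (K := K) hq (by linear_combination h3)

/-- The eighth power of the Gauss sum of an octic character. -/
theorem gaussSum_pow_eight (hq : q % 8 = 7) (hg : ∀ x, x ∈ Subgroup.zpowers g)
    (hp : p = 8 * e + 1) {χ : MulChar (ZMod p) K} (hχ : χ g ^ 4 = -1)
    {ψ : AddChar (ZMod p) K} (hψ : ψ.IsPrimitive) :
    gaussSum χ ψ ^ 8 = p * jacobiSum χ (χ ^ 4) ^ 4 * jacobiSum (χ ^ 2) (χ ^ 4) ^ 2 := by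
  have hquad := MulChar.pow_four_eq_quadraticChar hg hp hχ
  have hp2 : ringChar (ZMod p) ≠ 2 := by
    rw [ZMod.ringChar_zmod_n]
    omega
  have hne1 : χ ^ 1 ≠ 1 := MulChar.pow_ne_one_of_apply_generator (g := g) hq
    (.inl (by rw [pow_one, hχ]))
  have hne2 : χ ^ 2 ≠ 1 := MulChar.pow_ne_one_of_apply_generator (g := g) hq
    (.inr (.inl (by rw [← pow_mul, hχ])))
  have hne4 : χ ^ 4 ≠ 1 := MulChar.pow_ne_one_of_apply_generator (g := g) hq (.inr (.inr hχ))
  rw [pow_one] at hne1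
  have h1 := jacobiSum_mul_nontrivial (χ := χ) (φ := χ) (by rw [← sq]; exact hne2) ψ
  have h2 := jacobiSum_mul_nontrivial (χ := χ ^ 2) (φ := χ ^ 2) (by rw [← pow_add]; exact hne4) ψ
  rw [← sq] at h1
  rw [← pow_add] at h2
  have h4 : gaussSum (χ ^ 4) ψ ^ 2 = p := by
    have hQ : (χ ^ 4).IsQuadratic := by
      rw [hquad]; exact (quadraticChar_isQuadratic _).comp _
    rw [gaussSum_sq hne4 hQ hψ, ZMod.card, MulChar.pow_apply' _ (by norm_num),
      ← map_pow]
    norm_num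
  -- The factors χ(4) and χ²(4) relating J(χ, χ) and J(χ², χ²) to J(χ, χ⁴) and J(χ², χ⁴) disappear
  -- in the powers used, as χ(4)⁴ is the square of a quadratic symbol.
  have hfour : χ 4 ^ 4 = 1 := by
    have h20 : (2 : ZMod p) ≠ 0 := Ring.two_ne_zero hp2
    have : χ 4 ^ 4 = (χ ^ 4) 2 ^ 2 := by
      rw [MulChar.pow_apply' _ (by norm_num), ← map_pow, ← map_pow, ← map_pow]
      norm_num
    rw [this, hquad, MulChar.ringHomComp_apply]
    rcases quadraticChar_dichotomy h20 with h | h <;> rw [h] <;> simp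
  have j1 := jacobiSum_self_mul_apply_four hp2 hne1
  have j2 := jacobiSum_self_mul_apply_four hp2 hne2
  rw [← hquad] at j1 j2
  rw [MulChar.pow_apply' _ (by norm_num)] at j2
  have e1 : jacobiSum χ χ ^ 4 = jacobiSum χ (χ ^ 4) ^ 4 := by
    rw [← j1, mul_pow, hfour, one_mul]
  have e2 : jacobiSum (χ ^ 2) (χ ^ 2) ^ 2 = jacobiSum (χ ^ 2) (χ ^ 4) ^ 2 := by
    rw [← j2, mul_pow, ← pow_mul, hfour, one_mul]
  norm_num at h2
  calc gaussSum χ ψ ^ 8 = (gaussSum χ ψ * gaussSum χ ψ) ^ 4 := by ring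
    _ = (gaussSum (χ ^ 2) ψ * gaussSum (χ ^ 2) ψ) ^ 2 * jacobiSum χ χ ^ 4 := by rw [← h1]; ring
    _ = gaussSum (χ ^ 4) ψ ^ 2 * jacobiSum χ χ ^ 4 * jacobiSum (χ ^ 2) (χ ^ 2) ^ 2 := by
      rw [← h2]; ring
    _ = _ := by rw [h4, e1, e2]

/-- The Frobenius action on the Gauss sum of an octic character in characteristic
`q ≡ 7 (mod 8)`. -/
theorem gaussSum_pow_succ [hqf : Fact q.Prime] (hq : q % 8 = 7) (hpq : p ≠ q) (hg : ∀ x, x ∈ Subgroup.zpowers g)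
    {χ : MulChar (ZMod p) K} (hχ : χ g ^ 4 = -1) {ψ : AddChar (ZMod p) K} (hψ : ψ.IsPrimitive) :
    gaussSum χ ψ ^ (q + 1) = χ (-(q : ZMod p)) * p := by
  have h8 : χ ^ 8 = 1 := by
    rw [MulChar.eq_iff hg, MulChar.pow_apply_coe, MulChar.one_apply_coe]
    linear_combination (χ g ^ 4 - 1) * hχ
  have hne1 : χ ≠ 1 := by
    rw [← pow_one χ]
    exact MulChar.pow_ne_one_of_apply_generator (g := g) hq (.inl (by rw [pow_one, hχ]))
  -- Because q ≡ -1 mod 8, Frobenius inverts χ.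
  have hinv : χ ^ q = χ⁻¹ := by
    rw [eq_inv_iff_mul_eq_one, ← pow_succ, show q + 1 = 8 * ((q + 1) / 8) by omega, pow_mul, h8,
      one_pow]
  have hqu : IsUnit (q : ZMod p) := by
    rw [isUnit_iff_ne_zero, Ne, ZMod.natCast_eq_zero_iff]
    exact fun h => hpq ((Nat.prime_dvd_prime_iff_eq hpf.out hqf.out).mp h)
  have h1 : gaussSum χ ψ ^ q = χ q * gaussSum χ⁻¹ ψ := by
    rw [gaussSum_frob, hinv, AddChar.pow_mulShift, ← hqu.unit_spec, gaussSum_mulShift_eq, inv_inv]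
  have h2 := gaussSum_mul_gaussSum_eq_card hne1 hψ
  have h3 := mul_gaussSum_inv_eq_gaussSum χ⁻¹ ψ
  have h4 : χ⁻¹ (-1) = χ (-1) := by rw [MulChar.inv_apply', inv_neg, inv_one]
  rw [pow_succ, h1, ← h3, h4, neg_eq_neg_one_mul (q : ZMod p), map_mul]
  rw [ZMod.card] at h2
  rw [← h2]
  ring

/-- If `β = A + w` with `w ^ q = -w` has norm `x²`, its power with exponent `(q + 1) / 2` is
`x` times a Legendre symbol. -/
theorem add_pow_eq_mul_legendreSym {q : ℕ} [hqf : Fact q.Prime] {K : Type*} [Field K] [CharP K q] (hq : q % 8 = 7) {w : K} (hw : w ^ q = -w) {x A : ℤ}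
    (hnorm : (A : K) ^ 2 - w ^ 2 = (x : K) ^ 2) (hxA : ¬ (q : ℤ) ∣ x + A) :
    ((A : K) + w) ^ ((q + 1) / 2) = x * (legendreSym q (x + A) : K) := by
  have h2 : (2 : K) ≠ 0 := CharP.two_ne_zero_of_mod_eight hq
  have hxA' : ((x + A : ℤ) : K) ≠ 0 := by rwa [Ne, CharP.intCast_eq_zero_iff K q]
  have hint : ∀ n : ℤ, (n : K) ^ q = n := fun n => by
    rw [← frobenius_def, map_intCast]
  -- With β = A + w, the element v = x + β satisfies v² = 2(x+A)β, while Frobenius gives v^(q+1) =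
  -- 2x(x+A). Comparing the two computes β^((q+1)/2) up to Euler's criterion for 2(x+A).
  set v : K := ((x + A : ℤ) : K) + w with hv
  have hv2 : v ^ 2 = 2 * ((x + A : ℤ) : K) * (A + w) := by
    rw [hv]
    push_cast
    linear_combination -hnorm
  have hvq : v ^ (q + 1) = 2 * x * ((x + A : ℤ) : K) := by
    rw [pow_succ, hv, add_pow_char, hint, hw]
    push_cast
    linear_combination hnorm
  have hleg : ((2 * (x + A) : ℤ) : K) ^ (q / 2) = (legendreSym q (x + A) : K) := by
    have h2q : legendreSym q 2 = 1 := by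
      rw [legendreSym.at_two (by rintro rfl; omega), ZMod.χ₈_nat_eq_if_mod_eight]
      simp [hq]; omega
    have := legendreSym.eq_pow q (2 * (x + A))
    rw [legendreSym.mul, h2q, one_mul] at this
    have h := congrArg (ZMod.castHom (dvd_refl q) K) this
    rw [map_intCast, map_pow, map_intCast] at h
    exact h.symm
  have hleg2 : (legendreSym q (x + A) : K) ^ 2 = 1 := by
    have : ((x + A : ℤ) : ZMod q) ≠ 0 := by rwa [Ne, ZMod.intCast_zmod_eq_zero_iff_dvd]
    exact_mod_cast congrArg (Int.cast : ℤ → K) (legendreSym.sq_one q this)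
  have hpow : (2 * ((x + A : ℤ) : K)) ^ ((q + 1) / 2) =
      2 * ((x + A : ℤ) : K) * (legendreSym q (x + A) : K) := by
    rw [← hleg, show (q + 1) / 2 = q / 2 + 1 by omega, pow_succ]
    push_cast
    ring
  have key : 2 * ((x + A : ℤ) : K) * (legendreSym q (x + A) : K) *
      ((A : K) + w) ^ ((q + 1) / 2) = 2 * x * ((x + A : ℤ) : K) := by
    rw [← hpow, ← mul_pow, ← hv2, ← pow_mul, show 2 * ((q + 1) / 2) = q + 1 by omega, hvq]
  apply mul_left_cancel₀ (mul_ne_zero h2 hxA')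
  linear_combination (legendreSym q (x + A) : K) * key -
    2 * ((x + A : ℤ) : K) * ((A : K) + w) ^ ((q + 1) / 2) * hleg2

end GaussSum

/-! ### Powers of i and congruences between Gaussian fractions. -/

theorem zpow_eq_pow_toNat_mod_four {F : Type*} [Field F] {i : F} (hi : i ^ 2 = -1) (m : ℤ) :
    i ^ m = i ^ (m % 4).toNat := by
  have hi0 : i ≠ 0 := by rintro rfl; norm_num at hi
  have h4 : i ^ (4 : ℤ) = 1 := by
    have : i ^ 4 = 1 := by linear_combination (i ^ 2 - 1) * hi
    exact_mod_cast this
  rw [← zpow_natCast, Int.toNat_of_nonneg (by omega)]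
  conv_lhs => rw [← Int.mul_ediv_add_emod m 4]
  rw [zpow_add₀ hi0, zpow_mul, h4, one_zpow, one_mul]

theorem zpow_eq_zpow_iff_of_sq_eq_neg_one {F : Type*} [Field F] (h2 : (2 : F) ≠ 0) {i : F}
    (hi : i ^ 2 = -1) (m n : ℤ) : i ^ m = i ^ n ↔ (4 : ℤ) ∣ m - n := by
  have hi0 : i ≠ 0 := by rintro rfl; norm_num at hi
  have hord : orderOf i = 4 := by
    refine orderOf_eq_prime_pow (p := 2) (n := 1) ?_ (by linear_combination (i ^ 2 - 1) * hi)
    rw [pow_one, hi]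
    exact fun h => h2 (by linear_combination -h)
  have hprim : IsPrimitiveRoot i 4 := hord ▸ IsPrimitiveRoot.orderOf i
  rw [← Nat.cast_ofNat (n := 4), ← hprim.zpow_eq_one_iff_dvd, zpow_sub₀ hi0,
    div_eq_one_iff_eq (zpow_ne_zero _ hi0)]

section GaussianInt

variable {q : ℕ} [hqf : Fact q.Prime] {K : Type*} [Field K] [CharP K q]

/-- The norm of s vanishes mod q; since -1 is not a square mod q, both coordinates do. -/
theorem GaussianInt.natCast_dvd_of_lift_eq_zero (hq : q % 4 = 3) {f : GaussianInt →+* K}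
    {s : GaussianInt} (hs : f s = 0) : (q : GaussianInt) ∣ s := by
  have hn : f ((s.norm : ℤ) : GaussianInt) = 0 := by
    rw [Zsqrtd.norm_eq_mul_conj, map_mul, hs, zero_mul]
  rw [map_intCast, CharP.intCast_eq_zero_iff K q, Zsqrtd.norm_def,
    ← ZMod.intCast_zmod_eq_zero_iff_dvd] at hn
  push_cast at hn
  have him : (s.im : ZMod q) = 0 := by
    by_contra h
    exact ZMod.mod_four_ne_three_of_sq_eq_neg_sq' h (x := s.re) (by linear_combination hn) hq
  have hre : (s.re : ZMod q) = 0 := by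
    rw [him] at hn
    simpa using hn
  rw [ZMod.intCast_zmod_eq_zero_iff_dvd] at hre him
  have := (Zsqrtd.intCast_dvd (d := -1) (q : ℤ) s).mpr ⟨hre, him⟩
  exact_mod_cast this

/-- The congruence `GaussModEq` modulo a prime `q ≡ 3 (mod 4)`, read in a field of
characteristic `q`. -/
theorem gaussModEq_div_pow_iff (hq : q % 4 = 3) {c d : ℤ} (hcd : ¬ (q : ℤ) ∣ c ^ 2 + d ^ 2)
    {i : K} (hi : i ^ 2 = -1) (N : ℕ) (m : ℤ) :
    GaussModEq q ((((c : ℂ) - d * Complex.I) / (c + d * Complex.I)) ^ N) (Complex.I ^ m) ↔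
      (c - d * i) ^ N = i ^ m * (c + d * i) ^ N := by
  have hqp : Prime (q : ℤ) := Nat.prime_iff_prime_int.mp hqf.out
  rw [zpow_eq_pow_toNat_mod_four hi, zpow_eq_pow_toNat_mod_four Complex.I_sq]
  generalize (m % 4).toNat = k
  let f : GaussianInt →+* K := Zsqrtd.lift ⟨i, by push_cast; rw [← sq, hi]⟩
  have hf : ∀ a b : ℤ, f ⟨a, b⟩ = a + b * i := fun a b => rfl
  set α : GaussianInt := ⟨c, d⟩ with hα
  set β : GaussianInt := ⟨c, -d⟩ with hβ
  set D : GaussianInt := β ^ N - ⟨0, 1⟩ ^ k * α ^ N with hD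
  have hfD : f D = (c - d * i) ^ N - i ^ k * (c + d * i) ^ N := by
    rw [hD, map_sub, map_mul, map_pow, map_pow, map_pow, hf, hf, hf]
    push_cast
    ring
  have hαβ : α * β = ((c ^ 2 + d ^ 2 : ℤ) : GaussianInt) := by
    rw [hα, hβ, Zsqrtd.ext_iff, Zsqrtd.re_intCast, Zsqrtd.im_intCast, Zsqrtd.re_mul, Zsqrtd.im_mul]
    exact ⟨by ring, by ring⟩
  have hα0 : α ≠ 0 := by
    intro h
    rw [Zsqrtd.ext_iff] at h
    simp only [hα, Zsqrtd.re_zero, Zsqrtd.im_zero] at h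
    exact hcd (by rw [h.1, h.2]; simp)
  have hαc : GaussianInt.toComplex α = c + d * Complex.I := GaussianInt.toComplex_def' _ _
  have hβc : GaussianInt.toComplex β = c - d * Complex.I := by
    rw [hβ, GaussianInt.toComplex_def']; push_cast; ring
  have hic : GaussianInt.toComplex ⟨0, 1⟩ = Complex.I := by
    rw [GaussianInt.toComplex_def']; simp
  have hαc0 : GaussianInt.toComplex α ≠ 0 := by rwa [Ne, GaussianInt.toComplex_eq_zero]
  have hlhs : (((c : ℂ) - d * Complex.I) / (c + d * Complex.I)) ^ N - Complex.I ^ k =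
      GaussianInt.toComplex D / GaussianInt.toComplex α ^ N := by
    rw [← hαc, ← hβc, ← hic, hD, map_sub, map_mul, map_pow, map_pow, map_pow, div_pow]
    field_simp
  rw [← sub_eq_zero, ← hfD, GaussModEq, hlhs]
  constructor
  · rintro ⟨s, t, ht, h⟩
    have hft : f t ≠ 0 := by
      intro h0
      obtain ⟨u, v, huv⟩ := ht
      have := congrArg f huv
      rw [map_add, map_mul, map_mul, h0, map_natCast, CharP.cast_eq_zero] at this
      simp at this
    have ht0 : GaussianInt.toComplex t ≠ 0 := by
      rw [Ne, GaussianInt.toComplex_eq_zero]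
      rintro rfl
      exact hft (map_zero f)
    have h' : D * t = q * s * α ^ N := by
      apply GaussianInt.toComplex_injective
      rw [map_mul, map_mul, map_mul, map_pow, map_natCast]
      field_simp at h
      linear_combination h
    have := congrArg f h'
    rw [map_mul, map_mul, map_mul, map_natCast, CharP.cast_eq_zero, zero_mul, zero_mul] at this
    exact (mul_eq_zero.mp this).resolve_right hft
  · intro h
    obtain ⟨s, hs⟩ := GaussianInt.natCast_dvd_of_lift_eq_zero hq h
    refine ⟨s, α ^ N, IsCoprime.pow_left ?_, ?_⟩
    · have h1 : IsCoprime (c ^ 2 + d ^ 2) (q : ℤ) :=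
        ((Prime.coprime_iff_not_dvd hqp).mpr hcd).symm
      have h2 := h1.map (Int.castRingHom GaussianInt)
      rw [eq_intCast, eq_intCast, ← hαβ, Int.cast_natCast] at h2
      exact h2.of_mul_left_left
    · rw [hs, map_mul, map_natCast, map_pow, mul_div_assoc]

end GaussianInt

/-! ### The octic character at -q and the final equivalence. -/

/-- A prime is a sum of an odd and an even square in at most one way; here a congruence between
the two representations fixes the relative signs. -/
theorem eq_or_eq_neg_of_sq_add_sq {p : ℕ} [hpf : Fact p.Prime] {a b c d : ℤ}
    (hab : a ^ 2 + b ^ 2 = p) (hcd : c ^ 2 + d ^ 2 = p) (hb : Even b) (hd : Even d)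
    (hodd : Odd p) (h : (p : ℤ) ∣ a * d - b * c) : (a = c ∧ b = d) ∨ (a = -c ∧ b = -d) := by
  have hp0 : (0 : ℤ) < p := by exact_mod_cast hpf.out.pos
  obtain ⟨k, hk⟩ := h
  have hid : (a * d - b * c) ^ 2 + (a * c + b * d) ^ 2 = (p : ℤ) ^ 2 := by
    rw [sq (p : ℤ)]; nth_rewrite 1 [← hab]; rw [← hcd]; ring
  -- The identity (ad-bc)² + (ac+bd)² = p² forces |k| ≤ 1, and the parity of b and d makes k even.
  have hk0 : k = 0 := by
    have hk1 : k ^ 2 ≤ 1 := by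
      have : (p : ℤ) ^ 2 * k ^ 2 ≤ (p : ℤ) ^ 2 * 1 := by
        rw [hk] at hid
        nlinarith [sq_nonneg (a * c + b * d)]
      exact le_of_mul_le_mul_left this (by positivity)
    have heven : Even ((p : ℤ) * k) := by
      rw [← hk]
      exact (hd.mul_left a).sub (hb.mul_right c)
    have : Even k := by
      rcases Int.even_mul.mp heven with h1 | h1
      · exact absurd hodd (by rw [Nat.not_odd_iff_even]; exact_mod_cast h1)
      · exact h1
    obtain ⟨j, rfl⟩ := this
    have : j = 0 := by nlinarith
    omega
  rw [hk0, mul_zero] at hk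
  rw [hk] at hid
  have hpm : a * c + b * d = p ∨ a * c + b * d = -p :=
    sq_eq_sq_iff_eq_or_eq_neg.mp (by linear_combination hid)
  rcases hpm with h1 | h1
  · exact .inl ⟨mul_right_cancel₀ hp0.ne' (by linear_combination c * h1 + d * hk - a * hcd),
      mul_right_cancel₀ hp0.ne' (by linear_combination d * h1 - c * hk - b * hcd)⟩
  · exact .inr ⟨mul_right_cancel₀ hp0.ne' (by linear_combination c * h1 + d * hk - a * hcd),
      mul_right_cancel₀ hp0.ne' (by linear_combination d * h1 - c * hk - b * hcd)⟩

/-- The product of the half powers of `A + B √-2` and `c + d i` in characteristic `q`. -/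
theorem mul_pow_half_eq_card {p q : ℕ} [hpf : Fact p.Prime] [hqf : Fact q.Prime]
    (hp : p % 8 = 1) (hq : q % 8 = 7) {c d x y A B : ℤ}
    (hcd : (p : ℤ) = c ^ 2 + d ^ 2) (hxy : (p : ℤ) = x ^ 2 + 2 * q * y ^ 2)
    (hAB : (p : ℤ) = A ^ 2 + 2 * B ^ 2) (hc : Odd c) (hx : x % 4 = 1) (hA : A % 4 = 1)
    {K : Type*} [Field K] [CharP K q] {z : K} (hz : z ^ 4 = -1) :
    (((A : K) + B * (z + z ^ 3)) * (c + d * z ^ 2)) ^ ((q + 1) / 2) = p := by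
  obtain ⟨ε, hε, h1, h2, h3, h4⟩ := exists_common_legendreSym hp hq hcd hxy hAB hc hx hA
  have hqp : Prime (q : ℤ) := Nat.prime_iff_prime_int.mp hqf.out
  have hq2 : ¬ (q : ℤ) ∣ 2 := by
    intro h
    have := Int.le_of_dvd (by norm_num) h
    omega
  have hqx : ¬ (q : ℤ) ∣ x := by
    intro h
    have : (q : ℤ) ∣ p := by
      rw [hxy]
      exact dvd_add (dvd_pow h two_ne_zero) ⟨2 * y ^ 2, by ring⟩
    have := (Nat.prime_dvd_prime_iff_eq hqf.out hpf.out).mp (by exact_mod_cast this)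
    omega
  have hnot : ∀ t : ℤ, (q : ℤ) ∣ x + t → ¬ (q : ℤ) ∣ x - t := fun t ht ht' => by
    have : (q : ℤ) ∣ 2 * x := by
      rw [show 2 * x = (x + t) + (x - t) by ring]
      exact dvd_add ht ht'
    exact (hqp.dvd_or_dvd this).elim hq2 hqx
  have hint : ∀ n : ℤ, (n : K) ^ q = n := fun n => by
    rw [← frobenius_def, map_intCast]
  have hqK : ((q : ℕ) : K) = 0 := CharP.cast_eq_zero K q
  have hpx : (p : K) = (x : K) ^ 2 := by
    have := congrArg (Int.cast : ℤ → K) hxy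
    push_cast at this
    rw [this, hqK]
    ring
  have hpcd : (c : K) ^ 2 + (d : K) ^ 2 = (x : K) ^ 2 := by
    rw [← hpx]; exact_mod_cast (congrArg (Int.cast : ℤ → K) hcd).symm
  have hpAB : (A : K) ^ 2 + 2 * (B : K) ^ 2 = (x : K) ^ 2 := by
    rw [← hpx]; exact_mod_cast (congrArg (Int.cast : ℤ → K) hAB).symm
  have hε2 : (ε : K) ^ 2 = 1 := by
    rcases hε with rfl | rfl <;> norm_num
  obtain ⟨k, hk⟩ : ∃ k, q = 8 * k + 7 := ⟨q / 8, by omega⟩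
  have hz8 : z ^ 8 = 1 := by linear_combination (z ^ 4 - 1) * hz
  have hzq : z ^ q = -z ^ 3 := by
    rw [hk, pow_add, pow_mul, hz8, one_pow]
    linear_combination z ^ 3 * hz
  have hIq : (z ^ 2) ^ q = -z ^ 2 := by
    rw [← pow_mul, mul_comm, pow_mul, hzq]
    linear_combination z ^ 2 * hz
  have hsq : (z + z ^ 3) ^ q = -(z + z ^ 3) := by
    rw [add_pow_char, ← pow_mul, mul_comm 3, pow_mul, hzq]
    linear_combination (-z ^ 5 + z) * hz
  have hρ : ((A : K) + B * (z + z ^ 3)) ^ ((q + 1) / 2) = x * ε := by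
    have hw : ((B : K) * (z + z ^ 3)) ^ q = -((B : K) * (z + z ^ 3)) := by
      rw [mul_pow, hint, hsq]; ring
    have hs2 : (A : K) ^ 2 - ((B : K) * (z + z ^ 3)) ^ 2 = (x : K) ^ 2 := by
      linear_combination hpAB - (B : K) ^ 2 * (z ^ 2 + 2) * hz
    -- When q ∣ x+A, -x replaces x as the square root of the norm; its sign cancels against (-1/q) =
    -- -1.
    by_cases hxA : (q : ℤ) ∣ x + A
    · have hxA' := hnot A hxA
      have h := add_pow_eq_mul_legendreSym hq hw (x := -x) (A := A) (by push_cast; rw [hs2]; ring)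
        (by rwa [show -x + A = -(x - A) by ring, dvd_neg])
      have hneg : legendreSym q (-x + A) = -ε := by
        rw [show -x + A = -1 * (x - A) by ring, legendreSym.mul, h4 hxA',
          legendreSym.at_neg_one (by rintro rfl; omega), ZMod.χ₄_nat_three_mod_four (by omega)]
        ring
      rw [h, hneg]
      push_cast; ring
    · rw [add_pow_eq_mul_legendreSym hq hw hs2 hxA, h3 hxA]
  have hI : (z ^ 2) ^ ((q + 1) / 2) = 1 := by
    rw [← pow_mul, show 2 * ((q + 1) / 2) = 8 * (k + 1) by omega, pow_mul, hz8, one_pow]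
  -- Multiplying by i, harmless since i^((q+1)/2) = 1, moves d to the rational part: i(c+di) = -d+ci
  -- and i(c-di) = d+ci. In the second case Frobenius conjugates back.
  have hπ : ((c : K) + d * z ^ 2) ^ ((q + 1) / 2) = x * ε := by
    have hw : ((c : K) * z ^ 2) ^ q = -((c : K) * z ^ 2) := by
      rw [mul_pow, hint, hIq]; ring
    by_cases hxd : (q : ℤ) ∣ x + d
    · have hxd' := hnot d hxd
      have h := add_pow_eq_mul_legendreSym hq hw (x := x) (A := -d)
        (by push_cast; linear_combination hpcd - (c : K) ^ 2 * hz)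
        (by rwa [← sub_eq_add_neg])
      rw [← sub_eq_add_neg, h2 hxd', show ((-d : ℤ) : K) + c * z ^ 2 = z ^ 2 * (c + d * z ^ 2) by
        push_cast; linear_combination -(d : K) * hz, mul_pow, hI, one_mul] at h
      exact h
    · have h := add_pow_eq_mul_legendreSym hq hw (x := x) (A := d)
        (by linear_combination hpcd - (c : K) ^ 2 * hz) hxd
      rw [h1 hxd, show (d : K) + c * z ^ 2 = z ^ 2 * (c - d * z ^ 2) by
        linear_combination (d : K) * hz, mul_pow, hI, one_mul] at h
      have hconj : ((c : K) - d * z ^ 2) ^ q = c + d * z ^ 2 := by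
        rw [sub_pow_char, mul_pow, hint, hint, hIq]; ring
      rw [← hconj, pow_right_comm, h]
      exact_mod_cast (by simpa using hint (x * ε))
  rw [mul_pow, hρ, hπ, hpx]
  linear_combination (x : K) ^ 2 * hε2

theorem exists_int_sign_mod_four {a : ℤ} (ha : Odd a) : ∃ s : ℤ, (s = 1 ∨ s = -1) ∧ (s * a) % 4 = 1 := by
  have := Int.odd_iff.mp ha
  by_cases h : a % 4 = 1
  · exact ⟨1, .inl rfl, by omega⟩
  · exact ⟨-1, .inr rfl, by omega⟩

/-- The value of an octic character at `-q` for a prime `q ≡ 7 (mod 8)`. -/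
theorem octic_apply_neg_mul_pow {p q : ℕ} [hpf : Fact p.Prime] [hqf : Fact q.Prime]
    (hp : p % 8 = 1) (hq : q % 8 = 7) {c d x y : ℤ}
    (hcd : (p : ℤ) = c ^ 2 + d ^ 2) (hxy : (p : ℤ) = x ^ 2 + 2 * q * y ^ 2) (hc : Odd c)
    {g : (ZMod p)ˣ} (hg : ∀ u, u ∈ Subgroup.zpowers g)
    (hgcd : (c : ZMod p) + d * ((g : ZMod p) ^ ((p - 1) / 8)) ^ 2 = 0)
    {K : Type} [Field K] [CharP K q] {ζ : K} (hζ : IsPrimitiveRoot ζ p) {z : K} (hz : z ^ 4 = -1)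
    {χ : MulChar (ZMod p) K} (hχ : χ g = z) :
    χ (-(q : ZMod p)) * (c + d * z ^ 2) ^ ((q + 1) / 8) = (c - d * z ^ 2) ^ ((q + 1) / 8) := by
  set e := (p - 1) / 8 with he
  have hpe : p = 8 * e + 1 := by omega
  have hpq : p ≠ q := by omega
  have hpK : (p : K) ≠ 0 := by
    rw [Ne, CharP.cast_eq_zero_iff K q]
    exact fun h => hpq ((Nat.prime_dvd_prime_iff_eq hqf.out hpf.out).mp h).symm
  have hpodd : Odd p := Nat.odd_iff.mpr (by omega)
  have hdeven : Even d := by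
    have := Int.even_sq_add_sq_mod hp hc hcd
    exact Int.even_iff.mpr (by omega)
  obtain ⟨A, B, a, b, hAB, hab, -, hb, hgab, hJ⟩ := exists_jacobiSum_octic_eq hg hpe
  obtain ⟨hJ1, hJ2⟩ := hJ K z χ hz hχ
  have hdvd : (p : ℤ) ∣ a * d - b * c := by
    rw [← ZMod.intCast_zmod_eq_zero_iff_dvd]
    push_cast
    linear_combination (d : ZMod p) * hgab - (b : ZMod p) * hgcd
  have hJ2' : jacobiSum (χ ^ 2) (χ ^ 4) ^ 2 = ((c : K) + d * z ^ 2) ^ 2 := by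
    rw [hJ2]
    rcases eq_or_eq_neg_of_sq_add_sq hab hcd.symm hb hdeven hpodd hdvd with ⟨rfl, rfl⟩ | ⟨rfl, rfl⟩
    · rfl
    · push_cast; ring
  have hAodd : Odd A := by
    have h : Odd (A ^ 2) := by
      rw [show A ^ 2 = (p : ℤ) - 2 * B ^ 2 by linear_combination hAB]
      exact (by exact_mod_cast hpodd : Odd (p : ℤ)).sub_even (even_two_mul _)
    exact (Int.odd_pow.mp h).resolve_right two_ne_zero
  have hxodd : Odd x := by
    have h : Odd (x ^ 2) := by
      rw [show x ^ 2 = (p : ℤ) - 2 * (q * y ^ 2) by linear_combination -hxy]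
      exact (by exact_mod_cast hpodd : Odd (p : ℤ)).sub_even (even_two_mul _)
    exact (Int.odd_pow.mp h).resolve_right two_ne_zero
  -- The sign changes cost nothing: x enters only through x², and ρ through ρ^(4N).
  obtain ⟨s, hs, hsA⟩ := exists_int_sign_mod_four hAodd
  obtain ⟨s', hs', hsx⟩ := exists_int_sign_mod_four hxodd
  have hs2 : s ^ 2 = 1 := by rcases hs with rfl | rfl <;> rfl
  have hs2' : s' ^ 2 = 1 := by rcases hs' with rfl | rfl <;> rfl
  have hhalf := mul_pow_half_eq_card hp hq (x := s' * x) (y := y) (A := s * A) (B := s * B) hcd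
    (by linear_combination hxy - x ^ 2 * hs2')
    (by linear_combination -hAB - (A ^ 2 + 2 * B ^ 2) * hs2) hc hsx hsA hz
  set ρ : K := A + B * (z + z ^ 3) with hρ
  set π : K := c + d * z ^ 2 with hπ
  set π' : K := c - d * z ^ 2 with hπ'
  obtain ⟨N, hN⟩ : ∃ N, q + 1 = 8 * N := ⟨(q + 1) / 8, by omega⟩
  have hN8 : (q + 1) / 8 = N := by omega
  have hN2 : (q + 1) / 2 = 4 * N := by omega
  have hππ' : (p : K) = π * π' := by
    have := congrArg (Int.cast : ℤ → K) hcd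
    push_cast at this
    rw [this, hπ, hπ']
    linear_combination (d : K) ^ 2 * hz
  have hρπ : ρ ^ (4 * N) * π ^ (4 * N) = p := by
    have hsK : (s : K) ^ 4 = 1 := by
      rcases hs with rfl | rfl <;> norm_num
    rw [← hhalf, hN2, ← mul_pow]
    rw [show ((s * A : ℤ) : K) + ((s * B : ℤ) : K) * (z + z ^ 3) = s * ρ by
      rw [hρ]; push_cast; ring, mul_assoc, mul_pow (s : K), pow_mul (s : K), hsK, one_pow, one_mul]
  have : NeZero p := ⟨hpf.out.ne_zero⟩
  have hψ := AddChar.zmodChar_primitive_of_primitive_root p hζ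
  have hz' : χ g ^ 4 = -1 := by rw [hχ, hz]
  have h8 := gaussSum_pow_eight hq hg hpe hz' hψ
  have hq1 := gaussSum_pow_succ hq hpq hg hz' hψ
  rw [hN, pow_mul, h8, hJ1, hJ2'] at hq1
  rw [hN8]
  apply mul_left_cancel₀ hpK
  calc (p : K) * (χ (-(q : ZMod p)) * π ^ N) = χ (-(q : ZMod p)) * p * π ^ N := by ring
    _ = (p * ρ ^ 4 * π ^ 2) ^ N * π ^ N := by rw [hq1]
    _ = (ρ ^ (4 * N) * π ^ (4 * N)) * π' ^ N := by
      rw [pow_mul, pow_mul, ← mul_pow, ← mul_pow, ← mul_pow, hππ']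
      ring
    _ = p * π' ^ N := by rw [hρπ]

theorem exists_generator_pow_sq_eq {p e : ℕ} [hpf : Fact p.Prime] (hp : p = 8 * e + 1)
    {i : ZMod p} (hi : i ^ 2 = -1) :
    ∃ g : (ZMod p)ˣ, (∀ u, u ∈ Subgroup.zpowers g) ∧ ((g : ZMod p) ^ e) ^ 2 = i := by
  obtain ⟨g, hg⟩ := IsCyclic.exists_generator (α := (ZMod p)ˣ)
  have h4 := generator_pow_eq_neg_one hg hp
  have hsq : (((g : ZMod p) ^ e) ^ 2) ^ 2 = i ^ 2 := by rw [hi, ← h4]; ring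
  rcases sq_eq_sq_iff_eq_or_eq_neg.mp hsq with h | h
  · exact ⟨g, hg, h⟩
  -- The two square roots of -1 are inverse to each other, so inverting g corrects the sign.
  · refine ⟨g⁻¹, fun u => by rw [Subgroup.zpowers_inv]; exact hg u, ?_⟩
    have hi0 : i ≠ 0 := by rintro rfl; norm_num at hi
    rw [Units.val_inv_eq_inv_val, inv_pow, inv_pow, h, inv_neg, neg_eq_iff_eq_neg]
    exact inv_eq_of_mul_eq_one_right (by linear_combination -hi)

/-- Writing 2 = w², the representation of p gives -q = (x/(wy))² mod p. This makes χ(-q) a power of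
z², comparable with a power of d/c. -/
theorem exists_neg_eq_generator_pow {p q : ℕ} [hpf : Fact p.Prime] [hqf : Fact q.Prime]
    (hp : p % 8 = 1) (hpq : p ≠ q) {x y : ℤ} (hxy : (p : ℤ) = x ^ 2 + 2 * q * y ^ 2)
    {g : (ZMod p)ˣ} (hg : ∀ u, u ∈ Subgroup.zpowers g) :
    ∃ t : ℕ, -(q : ZMod p) = ((g : ZMod p) ^ 2) ^ t := by
  have hxyp : (x : ZMod p) ^ 2 + 2 * q * (y : ZMod p) ^ 2 = 0 := by
    have := congrArg (Int.cast : ℤ → ZMod p) hxy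
    push_cast at this
    rw [← this, ZMod.natCast_self]
  have hy0 : (y : ZMod p) ≠ 0 := by
    intro hy
    have hx : (x : ZMod p) = 0 := by
      rw [hy] at hxyp
      simpa using hxyp
    rw [ZMod.intCast_zmod_eq_zero_iff_dvd] at hx hy
    exact hpf.out.not_dvd_of_eq_sq_add hxy (Nat.prime_iff_prime_int.mp hpf.out) hx hy
  have hq0 : (q : ZMod p) ≠ 0 := by
    rw [Ne, ZMod.natCast_eq_zero_iff]
    exact fun h => hpq ((Nat.prime_dvd_prime_iff_eq hpf.out hqf.out).mp h)
  obtain ⟨w, hw⟩ : IsSquare (2 : ZMod p) :=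
    (ZMod.exists_sq_eq_two_iff (by rintro rfl; omega)).mpr (.inl hp)
  have hw0 : w ≠ 0 := by
    rintro rfl
    have h2 : (2 : ZMod p) = 0 := by rw [hw]; ring
    have : ((2 : ℕ) : ZMod p) = 0 := by exact_mod_cast h2
    rw [ZMod.natCast_eq_zero_iff] at this
    have := Nat.le_of_dvd (by norm_num) this
    have := hpf.out.one_lt
    omega
  have hsq : -(q : ZMod p) = (x / (w * y)) ^ 2 := by
    field_simp
    linear_combination -hxyp + (q : ZMod p) * (y : ZMod p) ^ 2 * hw
  have hu0 : (x : ZMod p) / (w * y) ≠ 0 := by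
    intro h
    rw [h] at hsq
    exact hq0 (by simpa using hsq)
  obtain ⟨t, ht⟩ := mem_powers_iff_mem_zpowers.mpr (hg (Units.mk0 _ hu0))
  refine ⟨t, ?_⟩
  have : (g : ZMod p) ^ t = x / (w * y) := by
    rw [← Units.val_pow_eq_pow_val]
    exact congrArg Units.val ht
  rw [hsq, ← this, pow_right_comm]

/-- The octic Gauss sum modulo `p`, computed in characteristic `q`, gives the equivalence for every
pair of representations; the coprimality hypothesis and the normalisation of `d` are not needed. -/
theorem theorem4p4 (p q : ℕ) [Fact p.Prime] [Fact q.Prime]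
    (hp : p % 8 = 1) (hq : q % 8 = 7)
    (c d x y d₀ : ℤ) (r : ℕ)
    (hcd : (p : ℤ) = c ^ 2 + d ^ 2)
    (hxy : (p : ℤ) = x ^ 2 + 2 * (q : ℤ) * y ^ 2)
    (hc : c ≡ 1 [ZMOD 4])
    (hd : d = 2 ^ r * d₀)
    (hd₀ : d₀ ≡ 1 [ZMOD 4])
    (hcop : Int.gcd c (x + d) = 1 ∨ Int.gcd d₀ (x + c) = 1)
    (m : ℤ) :
    (-(q : ZMod p)) ^ ((p - 1) / 8) = ((d : ZMod p) / (c : ZMod p)) ^ m ↔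
      GaussModEq q
        ((((c : ℂ) - (d : ℂ) * Complex.I) / ((c : ℂ) + (d : ℂ) * Complex.I)) ^ ((q + 1) / 8))
        (Complex.I ^ m) := by
  have hpf : p.Prime := Fact.out
  have hqf : q.Prime := Fact.out
  have hpq : p ≠ q := by omega
  have hcodd : Odd c := by
    have : c % 4 = 1 := hc
    exact Int.odd_iff.mpr (by omega)
  have hcdp : (c : ZMod p) ^ 2 + (d : ZMod p) ^ 2 = 0 := by
    have := congrArg (Int.cast : ℤ → ZMod p) hcd
    push_cast at this
    rw [← this, ZMod.natCast_self]
  have hc0 : (c : ZMod p) ≠ 0 := by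
    intro h
    have h' : (d : ZMod p) = 0 := by
      rw [h] at hcdp
      simpa using hcdp
    rw [ZMod.intCast_zmod_eq_zero_iff_dvd] at h h'
    exact hpf.not_dvd_of_eq_sq_add (k := 1) (by rw [hcd]; ring)
      (Nat.prime_iff_prime_int.mp hpf) h h'
  have hι : ((d : ZMod p) / c) ^ 2 = -1 := by
    field_simp
    linear_combination hcdp
  have hpe : p = 8 * ((p - 1) / 8) + 1 := by omega
  obtain ⟨g, hg, hgι⟩ := exists_generator_pow_sq_eq hpe hι
  obtain ⟨t, ht⟩ := exists_neg_eq_generator_pow hp hpq hxy hg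
  -- K provides both the p-th root of unity for the additive character and the eighth root z.
  let K := AlgebraicClosure (ZMod q)
  have : CharP K q := charP_of_injective_algebraMap (algebraMap (ZMod q) K).injective q
  have hpK : NeZero (p : K) := ⟨by
    rw [Ne, CharP.cast_eq_zero_iff K q]
    exact fun h => hpq ((Nat.prime_dvd_prime_iff_eq hqf hpf).mp h).symm⟩
  obtain ⟨ζ, hζ⟩ := HasEnoughRootsOfUnity.exists_primitiveRoot K p
  obtain ⟨z, hz⟩ := IsAlgClosed.exists_pow_nat_eq (-1 : K) (n := 4) (by norm_num)
  obtain ⟨χ, hχ⟩ := exists_mulChar_apply_generator hg hpe hz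
  have key := octic_apply_neg_mul_pow hp hq hcd hxy hcodd hg
    (by rw [hgι]; field_simp; linear_combination hcdp) hζ hz hχ
  have hI : (z ^ 2) ^ 2 = -1 := by rw [← pow_mul, hz]
  have hχq : χ (-(q : ZMod p)) = (z ^ 2) ^ (t : ℤ) := by
    rw [ht, map_pow, map_pow, hχ, zpow_natCast]
  have hlhs : (-(q : ZMod p)) ^ ((p - 1) / 8) = ((d : ZMod p) / c) ^ (t : ℤ) := by
    rw [ht, ← hgι, zpow_natCast]; ring
  have hqcd : ¬ (q : ℤ) ∣ c ^ 2 + d ^ 2 := by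
    rw [← hcd]
    intro h
    exact hpq ((Nat.prime_dvd_prime_iff_eq hqf hpf).mp (by exact_mod_cast h)).symm
  have hπ0 : ((c : K) + d * z ^ 2) ^ ((q + 1) / 8) ≠ 0 := by
    refine pow_ne_zero _ fun h => hpK.out ?_
    have := congrArg (Int.cast : ℤ → K) hcd
    push_cast at this
    rw [this]
    linear_combination ((c : K) - d * z ^ 2) * h + (d : K) ^ 2 * hz
  have h2p : (2 : ZMod p) ≠ 0 := Ring.two_ne_zero (by
    rw [ZMod.ringChar_zmod_n]
    omega)
  -- Both sides become t ≡ m mod 4, as d/c and z² each have order 4.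
  rw [gaussModEq_div_pow_iff (by omega) hqcd hI, ← key, mul_left_inj' hπ0, hχq, hlhs,
    zpow_eq_zpow_iff_of_sq_eq_neg_one h2p hι,
    zpow_eq_zpow_iff_of_sq_eq_neg_one (CharP.two_ne_zero_of_mod_eight hq) hI]
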